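/- All graphs are finite and simple. A non-empty set $K$ of vertices of a graph $G$ is a *simplicial clique* if $K$ is a clique and, for every $v\in K$, the set $N(v)\setminus K$ is a clique. A *hole* is an induced cycle of length at least four. A graph is *clean* if it contains none of the following as an induced subgraph: - a *claw* $K_{1,3}$; - a *jewel*: a hole $h_1,\dots,h_k$ ($k\ge 4$) together with a vertex $v$ outside the hole whose neighbours in the hole are exactly $h_1,h_2,h_3,h_4$; - a *line wheel*: a hole $h_1,\dots,h_k$ ($k\ge 6$) together with a vertex $v$ outside the hole whose neighbours in the hole are exactly $h_1,h_2,h_i,h_{i+1}$ for some $i\in\{4,\dots,k-2\}$; - a *short prism*: a hole $h_1,h_2,h_3,h_4$ together with an induced path $p_1,\dots,p_k$ disjoint from it ($k\ge 1$), such that $p_1$ is adjacent to $h_1,h_2$, $p_k$ is adjacent to $h_3,h_4$, and there are no other edges between the hole and the path; - a *seven-antihole*: the complement of a cycle with seven vertices. **Theorem.** There is an algorithm that, given a clean graph $G$ with at least one vertex, outputs a simplicial clique of $G$ in time $O(|V(G)|^5)$. Here the algorithm is a program for a word RAM with words of $O(\log |V(G)|)$ bits, in which each of the following instructions costs one unit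 of time: load a constant, addition, truncated subtraction, multiplication, reading or writing a memory cell, jump, and jump on a comparison. The input is $|V(G)|$ and the adjacency matrix of $G$. The output is the characteristic vector of the simplicial clique. -/

import Mathlib

/-! ### Graphs -/

/-- A nonempty clique `K` such that `N(v) \ K` is a clique for every `v ∈ K`. -/
def IsSimplicialClique {V : Type*} (G : SimpleGraph V) (K : Set V) : Prop :=
  K.Nonempty ∧ G.IsClique K ∧ ∀ v ∈ K, G.IsClique (G.neighborSet v \ K)

/-- `G` has no induced subgraph isomorphic to `K_{1,3}`. -/
def IsClawFree {V : Type*} (G : SimpleGraph V) : Prop :=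
  ¬ (completeBipartiteGraph (Fin 1) (Fin 3)).IsIndContained G

/-- `G` contains a jewel as an induced subgraph: a hole `h₀ - ⋯ - h_{k-1} - h₀` of length `k ≥ 4`
(an induced cycle, given as an embedding of the `k`-cycle) and a vertex `v` outside the hole whose
neighbours in the hole are exactly `h₀, h₁, h₂, h₃`. -/
def ContainsJewel {V : Type*} (G : SimpleGraph V) : Prop :=
  ∃ (k : ℕ) (h : SimpleGraph.cycleGraph k ↪g G) (v : V),
    4 ≤ k ∧ (∀ i, h i ≠ v) ∧ ∀ i : Fin k, G.Adj v (h i) ↔ (i : ℕ) < 4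

/-- `G` contains a line wheel as an induced subgraph: a hole `h₀ - ⋯ - h_{k-1} - h₀` of length
`k ≥ 6` and a vertex `v` outside the hole whose neighbours in the hole are exactly
`h₀, h₁, h_j, h_{j+1}`, for some `3 ≤ j ≤ k - 3`. -/
def ContainsLineWheel {V : Type*} (G : SimpleGraph V) : Prop :=
  ∃ (k : ℕ) (h : SimpleGraph.cycleGraph k ↪g G) (v : V) (j : ℕ),
    6 ≤ k ∧ 3 ≤ j ∧ j + 3 ≤ k ∧ (∀ i, h i ≠ v) ∧
    ∀ i : Fin k, G.Adj v (h i) ↔ ((i : ℕ) = 0 ∨ (i : ℕ) = 1 ∨ (i : ℕ) = j ∨ (i : ℕ) = j + 1)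

/-- `G` contains a short prism as an induced subgraph: a hole `h₀ - h₁ - h₂ - h₃ - h₀` and an
induced path `p₀ - ⋯ - p_m` disjoint from it, where the edges between the two are exactly those
from `p₀` to `h₀, h₁` and from `p_m` to `h₂, h₃`. -/
def ContainsShortPrism {V : Type*} (G : SimpleGraph V) : Prop :=
  ∃ (m : ℕ) (h : SimpleGraph.cycleGraph 4 ↪g G) (p : SimpleGraph.pathGraph (m + 1) ↪g G),
    (∀ i j, h i ≠ p j) ∧
    ∀ (i : Fin 4) (j : Fin (m + 1)), G.Adj (h i) (p j) ↔
      (((j : ℕ) = 0 ∧ (i = 0 ∨ i = 1)) ∨ ((j : ℕ) = m ∧ (i = 2 ∨ i = 3)))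

/-- `G` contains the complement of the seven-vertex cycle as an induced subgraph. -/
def ContainsSevenAntihole {V : Type*} (G : SimpleGraph V) : Prop :=
  (SimpleGraph.cycleGraph 7)ᶜ.IsIndContained G

/-- Clean graphs. -/
def IsClean {V : Type*} (G : SimpleGraph V) : Prop :=
  IsClawFree G ∧ ¬ ContainsJewel G ∧ ¬ ContainsLineWheel G ∧ ¬ ContainsShortPrism G ∧
    ¬ ContainsSevenAntihole G

/-! ### Word RAM: a random access machine whose words are natural numbers below a bound `W` -/

namespace WordRAM

/-- Instructions; `r`, `a`, `b` are register numbers, `v` a constant, `l` a program line.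
Each executed instruction costs one unit of time. -/
inductive Instr : Type
  /-- `R[r] := v` -/
  | const (r v : ℕ)
  /-- `R[r] := R[a] + R[b]` -/
  | add (r a b : ℕ)
  /-- `R[r] := R[a] - R[b]`, or `0` if `R[a] < R[b]` -/
  | sub (r a b : ℕ)
  /-- `R[r] := R[a] * R[b]` -/
  | mul (r a b : ℕ)
  /-- `R[r] := M[R[a]]` -/
  | load (r a : ℕ)
  /-- `M[R[a]] := R[b]` -/
  | store (a b : ℕ)
  /-- go to line `l` -/
  | jmp (l : ℕ)
  /-- go to line `l` if `R[a] = R[b]` -/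
  | jeq (a b l : ℕ)
  /-- go to line `l` if `R[a] < R[b]` -/
  | jlt (a b l : ℕ)

/-- A program is a finite list of instructions, with lines numbered from `0`. -/
abbrev Program : Type := List Instr

/-- A configuration: program counter, registers, and memory. -/
structure Config : Type where
  pc : ℕ
  reg : ℕ → ℕ
  mem : ℕ → ℕ

/-- Put `v` into register `r` and go to the next line; the machine crashes (`none`) if `v` does
not fit into a word. -/
def Config.write (W : ℕ) (s : Config) (r v : ℕ) : Option Config :=
  if v < W then some ⟨s.pc + 1, Function.update s.reg r v, s.mem⟩ else none

/-- Go to line `l` if `b` holds, and to the next line otherwise. -/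
def Config.branch (s : Config) (b : Prop) [Decidable b] (l : ℕ) : Option Config :=
  some ⟨if b then l else s.pc + 1, s.reg, s.mem⟩

/-- Execute one instruction with words bounded by `W`. -/
def Instr.exec (W : ℕ) (s : Config) : Instr → Option Config
  | .const r v => s.write W r v
  | .add r a b => s.write W r (s.reg a + s.reg b)
  | .sub r a b => s.write W r (s.reg a - s.reg b)
  | .mul r a b => s.write W r (s.reg a * s.reg b)
  | .load r a => s.write W r (s.mem (s.reg a))
  | .store a b => some ⟨s.pc + 1, s.reg, Function.update s.mem (s.reg a) (s.reg b)⟩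
  | .jmp l => s.branch True l
  | .jeq a b l => s.branch (s.reg a = s.reg b) l
  | .jlt a b l => s.branch (s.reg a < s.reg b) l

/-- One step of the program `P`; there is none if no instruction stands in the current line, or if
the instruction crashes. -/
def step (W : ℕ) (P : Program) (s : Config) : Option Config :=
  P[s.pc]?.bind (Instr.exec W s)

/-- `Steps W P t s s'`: from `s`, the program `P` reaches `s'` in exactly `t` steps. -/
inductive Steps (W : ℕ) (P : Program) : ℕ → Config → Config → Prop
  | refl (s : Config) : Steps W P 0 s s
  | head {t : ℕ} {s s' s'' : Config} :
      step W P s = some s' → Steps W P t s' s'' → Steps W P (t + 1) s s''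

/-- The machine has halted (properly, not by a crash): control has left the program. -/
def Halted (P : Program) (s : Config) : Prop := P.length ≤ s.pc

open Classical in
/-- The initial configuration on a graph with vertex set `{0, …, n - 1}`: register `0` holds `n`,
the adjacency matrix stands row by row in the memory cells `0, …, n² - 1` (the entry `(i, j)` in
cell `i n + j`), and everything else is `0`. -/
noncomputable def init {n : ℕ} (G : SimpleGraph (Fin n)) : Config where
  pc := 0
  reg := fun r => if r = 0 then n else 0
  mem := fun x => if ∃ i j : Fin n, x = (i : ℕ) * n + j ∧ G.Adj i j then 1 else 0

open Classical in
/-- The configuration outputs the set `K` of vertices: its characteristic vector stands in the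
memory cells `n², …, n² + n - 1`. -/
def Outputs {n : ℕ} (s : Config) (K : Set (Fin n)) : Prop :=
  ∀ i : Fin n, s.mem (n * n + i) = if i ∈ K then 1 else 0

/-- On input `G`, with words of `w` bits, the program `P` halts after at most `T` steps and outputs
the set `K`. -/
def Computes (w : ℕ) (P : Program) {n : ℕ} (G : SimpleGraph (Fin n)) (T : ℕ) (K : Set (Fin n)) :
    Prop :=
  ∃ (t : ℕ) (s : Config), t ≤ T ∧ Steps (2 ^ w) P t (init G) s ∧ Halted P s ∧ Outputs s K

end WordRAM

/-! Every clean graph has a simplicial clique of the form N[y] ∩ N[z] or N[y] \ N[z] that contains y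
(`exists_good`). There are only 2n² such candidates, and running through all triples of vertices
tests one of them in O(n³) steps, which gives O(n⁵) in total (`triple_search`, `computes_search`).
The program is verified with Hoare triples that carry a time bound.

For existence, let G be connected and not complete. Among the nonadjacent pairs r, d choose one for
which the component D of d in G − N[r] is smallest. Take a maximal connected set X containing r that
does not dominate D. Let N be the set of vertices outside X with a neighbour in X, and Y the set of
vertices of D outside X without one. Maximality makes N complete to Y, and then claw-freeness makes
Y a clique (`exists_endFrame`).

Fix y in Y. An induced path through X joining two nonadjacent members of N closes up with y to a
hole. Claws, jewels and line wheels being excluded, a further member of N can meet such a path in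
very few ways (`touch`, `touch_of_not_adj`, `touch_all`). Consequently N has no induced four-vertex
path (`no_path`; the seven-antihole enters here). So if N is not a clique, it is the union of
cliques A, B, U with A anticomplete to B and U complete to both (`exists_split`).

Either all vertices of U have their X-neighbours on the side of A, or all on the side of B, or all
of them straddle. If U leans to A, then Y ∪ B ∪ U is a simplicial clique. If U straddles, then Y ∪ A
or Y ∪ B is one, unless some c in U misses an X-neighbour x of some a in A and an X-neighbour x' of
some b in B (`good_or_obstacle`). In that case x and x' lie in different components of G − N[c], and
one of these components is properly contained in D, against the choice of r and d
(`obstacle_reach_lt`). -/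

namespace CleanGraph
variable {V : Type*} {G : SimpleGraph V}

/-! ### Induced paths as lists -/

/-- A list of vertices forming an induced path, in order. -/
def IndPath (G : SimpleGraph V) : List V → Prop
  | [] => True
  | x :: l => (∀ z ∈ l, x ≠ z ∧ (G.Adj x z ↔ l.head? = some z)) ∧ IndPath G l

theorem IndPath.snoc {l : List V} {z : V} (hl : IndPath G l)
    (hz : ∀ x ∈ l, x ≠ z ∧ (G.Adj x z ↔ l.getLast? = some x)) : IndPath G (l ++ [z]) := by
  induction l with
  | nil => simp [IndPath]
  | cons x l ih =>
    obtain ⟨h1, h2⟩ := hl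
    cases l with
    | nil =>
      have := hz x (by simp)
      simp at this
      simp [IndPath, this]
    | cons y l =>
      refine ⟨?_, ih h2 ?_⟩
      · intro w hw
        have hw : w ∈ (y :: l) ++ [z] := hw
        rw [List.mem_append, List.mem_singleton] at hw
        rcases hw with hw | rfl
        · simpa using h1 w hw
        · obtain ⟨h3, h4⟩ := hz x (by simp)
          refine ⟨h3, ?_⟩
          rw [h4]
          have hx : x ∉ y :: l := fun h => (h1 x h).1 rfl
          have h5 : ¬ (x :: y :: l).getLast? = some x := by
            rw [List.getLast?_cons_cons]
            exact fun h => hx (List.mem_of_getLast? h)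
          have h6 := (hz y (by simp)).1
          simp only [h5, false_iff]
          simpa using h6
      · intro w hw
        have := hz w (List.mem_cons_of_mem _ hw)
        rwa [List.getLast?_cons_cons] at this

theorem IndPath.reverse {l : List V} (hl : IndPath G l) : IndPath G l.reverse := by
  induction l with
  | nil => simp [IndPath]
  | cons x l ih =>
    rw [List.reverse_cons]
    refine (ih hl.2).snoc fun w hw => ?_
    have := hl.1 w (List.mem_reverse.1 hw)
    rw [List.getLast?_reverse, G.adj_comm]
    exact ⟨this.1.symm, this.2⟩

theorem IndPath.suffix {l l' : List V} (hl : IndPath G l) (h : l' <:+ l) : IndPath G l' := by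
  induction l with
  | nil => simp_all
  | cons x l ih =>
    rcases List.suffix_cons_iff.1 h with rfl | h
    · exact hl
    · exact ih hl.2 h

theorem IndPath.getElem {l : List V} (hl : IndPath G l) {i j : ℕ} (hij : i < j)
    (hj : j < l.length) : l[i] ≠ l[j] ∧ (G.Adj l[i] l[j] ↔ j = i + 1) := by
  induction l generalizing i j with
  | nil => simp at hj
  | cons x l ih =>
    obtain ⟨j, rfl⟩ : ∃ j', j = j' + 1 := ⟨j - 1, by omega⟩
    simp only [List.length_cons, Nat.add_lt_add_iff_right] at hj
    cases i with
    | zero =>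
      have h := hl.1 l[j] (List.getElem_mem hj)
      refine ⟨by simpa using h.1, ?_⟩
      simp only [List.getElem_cons_zero, List.getElem_cons_succ]
      rw [h.2]
      cases j with
      | zero => simp [List.head?_eq_getElem?, hj]
      | succ j =>
        have := (ih hl.2 (Nat.succ_pos j) hj).1
        simp [List.head?_eq_getElem?, this, List.getElem?_eq_getElem (Nat.lt_of_le_of_lt (Nat.zero_le _) hj)]
    | succ i => simpa using ih hl.2 (i := i) (j := j) (by omega) hj

/-- An induced path contains a suffix whose first vertex is its only vertex with property `p`. -/
theorem exists_suffix {l : List V} (p : V → Prop) (h : ∃ z ∈ l, p z) :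
    ∃ z l', z :: l' <:+ l ∧ p z ∧ ∀ w ∈ l', ¬ p w := by
  induction l with
  | nil => simp at h
  | cons x l ih =>
    by_cases h' : ∃ z ∈ l, p z
    · obtain ⟨z, l', h1, h2⟩ := ih h'
      exact ⟨z, l', h1.trans (List.suffix_cons _ _), h2⟩
    · push Not at h'
      obtain ⟨z, hz, hpz⟩ := h
      rcases List.mem_cons.1 hz with rfl | hz
      · exact ⟨z, l, List.suffix_refl _, hpz, h'⟩
      · exact absurd hpz (h' z hz)

/-! ### Holes as sequences -/

/-- A cyclic sequence `f 0, …, f (k - 1)` of vertices forming an induced cycle. -/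
def Hole (G : SimpleGraph V) (f : ℕ → V) (k : ℕ) : Prop :=
  ∀ i j, i < j → j < k → f i ≠ f j ∧ (G.Adj (f i) (f j) ↔ j = i + 1 ∨ (i = 0 ∧ j + 1 = k))

/-- A hole only looks at indices below its length, so the default value `x` of `getD` is never
reached. -/
theorem hole_of_list {x : V} {l : List V} (hl : IndPath G l)
    (hx : ∀ z ∈ l, x ≠ z ∧ (G.Adj x z ↔ l.head? = some z ∨ l.getLast? = some z)) :
    Hole G (fun i => (x :: l).getD i x) (l.length + 1) := by
  intro i j hij hj
  obtain ⟨j, rfl⟩ : ∃ j', j = j' + 1 := ⟨j - 1, by omega⟩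
  have hj' : j < l.length := by omega
  cases i with
  | zero =>
    have h := hx l[j] (List.getElem_mem hj')
    simp only [List.getD_cons_zero, List.getD_cons_succ, List.getD_eq_getElem _ _ hj']
    refine ⟨h.1, h.2.trans ?_⟩
    have e1 : l.head? = some l[j] ↔ j = 0 := by
      rw [List.head?_eq_getElem?, List.getElem?_eq_getElem (by omega : 0 < l.length)]
      rcases Nat.eq_zero_or_pos j with rfl | h0
      · simp
      · simpa [h0.ne'] using (hl.getElem h0 hj').1
    have e2 : l.getLast? = some l[j] ↔ j + 1 = l.length := by
      rw [List.getLast?_eq_getElem?, List.getElem?_eq_getElem (by omega : l.length - 1 < l.length)]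
      rcases Nat.lt_or_ge j (l.length - 1) with h0 | h0
      · have := (hl.getElem h0 (by omega)).1
        simp only [Option.some.injEq]
        exact ⟨fun h => absurd h.symm this, fun h => by omega⟩
      · have : j = l.length - 1 := by omega
        subst this
        simp; omega
    rw [e1, e2]
    simp
  | succ i =>
    simp only [List.getD_cons_succ, List.getD_eq_getElem _ _ hj',
      List.getD_eq_getElem _ _ (by omega : i < l.length)]
    have := hl.getElem (i := i) (j := j) (by omega) hj'
    refine ⟨this.1, this.2.trans ?_⟩
    omega

theorem cycleGraph_adj_iff {k : ℕ} (hk : 3 ≤ k) (i j : Fin k) :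
    (SimpleGraph.cycleGraph k).Adj i j ↔ (j : ℕ) = i + 1 ∨ (i : ℕ) = j + 1 ∨
      ((i : ℕ) = 0 ∧ (j : ℕ) + 1 = k) ∨ ((j : ℕ) = 0 ∧ (i : ℕ) + 1 = k) := by
  rw [SimpleGraph.cycleGraph_adj']
  have hi := i.2
  have hj := j.2
  rcases lt_trichotomy (i : ℕ) (j : ℕ) with h | h | h
  · have e1 : ((j - i : Fin k) : ℕ) = j - i := Fin.sub_val_of_le (le_of_lt h)
    have e2 : ((i - j : Fin k) : ℕ) = k - j + i := by
      rw [Fin.val_sub, Nat.mod_eq_of_lt (by omega)]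
    omega
  · have : i = j := Fin.ext h
    subst this
    have e2 : ((i - i : Fin k) : ℕ) = 0 := by rw [Fin.val_sub, Nat.sub_add_cancel hi.le, Nat.mod_self]
    omega
  · have e1 : ((i - j : Fin k) : ℕ) = i - j := Fin.sub_val_of_le (le_of_lt h)
    have e2 : ((j - i : Fin k) : ℕ) = k - i + j := by
      rw [Fin.val_sub, Nat.mod_eq_of_lt (by omega)]
    omega

/-- The embedding of a cycle given by a hole. -/
def Hole.embedding {f : ℕ → V} {k : ℕ} (h : Hole G f k) (hk : 3 ≤ k) :
    SimpleGraph.cycleGraph k ↪g G where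
  toFun i := f i
  inj' i j hij := by
    by_contra hne
    rcases lt_or_gt_of_ne (fun e => hne (Fin.ext e) : (i : ℕ) ≠ j) with h' | h'
    · exact (h i j h' j.2).1 hij
    · exact (h j i h' i.2).1 hij.symm
  map_rel_iff' := by
    intro i j
    change G.Adj (f i) (f j) ↔ _
    rw [cycleGraph_adj_iff hk]
    rcases lt_trichotomy (i : ℕ) (j : ℕ) with h' | h' | h'
    · rw [(h i j h' j.2).2]; omega
    · rw [h']; simp; omega
    · rw [G.adj_comm, (h j i h' i.2).2]; omega

/-! ### Forbidden induced subgraphs in terms of lists -/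

/-- There is no jewel, in terms of lists: the hole is `b, y, a, p, R` and the extra vertex is `c`. -/
theorem jewel_false (hG : ¬ ContainsJewel G) {b y a p c : V} {R : List V}
    (hP : IndPath G (p :: R)) (ha : ∀ z ∈ p :: R, a ≠ z ∧ (G.Adj a z ↔ z = p))
    (hb : ∀ z ∈ p :: R, b ≠ z ∧ (G.Adj b z ↔ (p :: R).getLast? = some z))
    (hy : ∀ z ∈ p :: R, y ≠ z ∧ ¬ G.Adj y z) (hya : G.Adj y a) (hyb : G.Adj y b) (hab : a ≠ b)
    (hab' : ¬ G.Adj a b) (hcb : G.Adj c b) (hcy : G.Adj c y) (hca : G.Adj c a) (hcp : G.Adj c p)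
    (hc : ∀ z ∈ R, ¬ G.Adj c z) : False := by
  have h1 : IndPath G (a :: p :: R) :=
    ⟨fun z hz => ⟨(ha z hz).1, by simpa [eq_comm] using (ha z hz).2⟩, hP⟩
  have h2 : IndPath G (y :: a :: p :: R) := by
    refine ⟨fun z hz => ?_, h1⟩
    rcases List.mem_cons.1 hz with rfl | hz
    · simp [hya, hya.ne]
    · have := (ha z hz).1
      simp [hy z hz, this]
  have hla : (a :: p :: R).getLast? = (p :: R).getLast? := List.getLast?_cons_cons
  have hly : (y :: a :: p :: R).getLast? = (p :: R).getLast? := by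
    rw [List.getLast?_cons_cons, hla]
  have hm : ∀ z, (p :: R).getLast? = some z → z ∈ p :: R := fun z h => List.mem_of_getLast? h
  have h3 : Hole G _ _ := hole_of_list (x := b) h2 (by
    intro z hz
    rw [hly]
    rcases List.mem_cons.1 hz with rfl | hz
    · simp [hyb.symm, hyb.ne']
    rcases List.mem_cons.1 hz with rfl | hz
    · refine ⟨hab.symm, ?_⟩
      simp only [G.adj_comm b z, hab', false_iff, List.head?_cons, Option.some.injEq, not_or]
      exact ⟨hya.ne, fun h => (ha z (hm z h)).1 rfl⟩
    · refine ⟨(hb z hz).1, ?_⟩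
      rw [(hb z hz).2]
      simp [(hy z hz).1])
  have key : ∀ i < (y :: a :: p :: R).length + 1,
      G.Adj c ((b :: y :: a :: p :: R).getD i b) ↔ i < 4 := by
    intro i hi
    match i with
    | 0 => simpa using hcb
    | 1 => simpa using hcy
    | 2 => simpa using hca
    | 3 => simpa using hcp
    | i + 4 =>
      have hi' : i < R.length := by simpa using hi
      simp only [List.getD_cons_succ, List.getD_eq_getElem _ _ hi', hc _ (List.getElem_mem hi'),
        false_iff]
      omega
  refine hG ⟨_, h3.embedding (by simp), c, by simp, ?_, fun i => key i i.2⟩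
  -- If `c` were on the hole, its index would be at least 4, as it is not adjacent to itself; but
  -- the neighbours of `a`, which has index 2, have indices 1 and 3.
  intro i hi
  have hi : (b :: y :: a :: p :: R).getD i b = c := hi
  have hci := key i i.2
  rw [hi] at hci
  have hge : ¬ (i : ℕ) < 4 := by simpa using hci
  have h5 := (h3 2 i (by omega) i.2).2
  change G.Adj a ((b :: y :: a :: p :: R).getD i b) ↔ _ at h5
  rw [hi] at h5
  have := h5.1 hca.symm
  omega

/-- There is no line wheel, in terms of lists: the hole is `b, y, a, P` and the extra vertex `c` is
adjacent to `y`, `a` and two consecutive vertices of `P`. -/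
theorem lineWheel_false (hG : ¬ ContainsLineWheel G) {b y a c : V} {P : List V} {i : ℕ}
    (hP : IndPath G P) (ha : ∀ z ∈ P, a ≠ z ∧ (G.Adj a z ↔ P.head? = some z))
    (hb : ∀ z ∈ P, b ≠ z ∧ (G.Adj b z ↔ P.getLast? = some z))
    (hy : ∀ z ∈ P, y ≠ z ∧ ¬ G.Adj y z) (hya : G.Adj y a) (hyb : G.Adj y b) (hab : a ≠ b)
    (hab' : ¬ G.Adj a b) (hcb : ¬ G.Adj c b) (hcy : G.Adj c y) (hca : G.Adj c a)
    (hi : 1 ≤ i) (hi' : i + 1 < P.length)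
    (hc : ∀ j (hj : j < P.length), G.Adj c P[j] ↔ j = i ∨ j = i + 1) : False := by
  have h0 : IndPath G (P ++ [b]) := hP.snoc fun x hx => ⟨(hb x hx).1.symm, by
    rw [G.adj_comm, (hb x hx).2]⟩
  have hne : P ≠ [] := by rintro rfl; simp at hi'
  have hhead : (P ++ [b]).head? = P.head? := by
    cases P with
    | nil => exact absurd rfl hne
    | cons => rfl
  have h1 : IndPath G (a :: (P ++ [b])) := by
    refine ⟨fun z hz => ?_, h0⟩
    rw [hhead]
    rcases List.mem_append.1 hz with hz | hz
    · exact ha z hz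
    · obtain rfl := List.mem_singleton.1 hz
      simp only [hab', false_iff]
      exact ⟨hab, fun h => (hb z (List.mem_of_head? h)).1 rfl⟩
  have hlast : (a :: (P ++ [b])).getLast? = some b := by
    rw [← List.cons_append, List.getLast?_append]
    simp
  have h3 : Hole G _ _ := hole_of_list (x := y) h1 (by
    intro z hz
    rw [hlast]
    rcases List.mem_cons.1 hz with rfl | hz
    · simp [hya, hya.ne]
    rcases List.mem_append.1 hz with hz | hz
    · have h5 := (ha z hz).1
      have h6 := (hb z hz).1
      simp [hy z hz, h5, h6]
    · obtain rfl := List.mem_singleton.1 hz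
      simp [hyb, hyb.ne])
  have key : ∀ j < (a :: (P ++ [b])).length + 1,
      G.Adj c ((y :: a :: (P ++ [b])).getD j y) ↔ (j = 0 ∨ j = 1 ∨ j = i + 2 ∨ j = i + 2 + 1) := by
    intro j hj
    match j with
    | 0 => simpa using hcy
    | 1 => simpa using hca
    | j + 2 =>
      have hj' : j < P.length + 1 := by simpa using hj
      simp only [List.getD_cons_succ]
      rw [List.getD_eq_getElem _ _ (by simpa using hj')]
      rcases Nat.lt_or_ge j P.length with h | h
      · rw [List.getElem_append_left h, hc j h]; omega
      · rw [List.getElem_append_right h]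
        simp only [List.getElem_singleton, hcb, false_iff]; omega
  refine hG ⟨_, h3.embedding (by simp), c, i + 2, by simp; omega, by omega, by simp; omega, ?_,
    fun i => key i i.2⟩
  -- If `c` were on the hole, it would be a common neighbour of the consecutive vertices `y` and
  -- `a`, which a hole does not have.
  intro j hj
  have hj : (y :: a :: (P ++ [b])).getD j y = c := hj
  have hcj := key j j.2
  rw [hj] at hcj
  have hge : ¬ ((j : ℕ) = 0 ∨ (j : ℕ) = 1 ∨ (j : ℕ) = i + 2 ∨ (j : ℕ) = i + 2 + 1) := by
    simpa using hcj
  have h5 := (h3 0 j (by omega) j.2).2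
  have h6 := (h3 1 j (by omega) j.2).2
  change G.Adj y ((y :: a :: (P ++ [b])).getD j y) ↔ _ at h5
  change G.Adj a ((y :: a :: (P ++ [b])).getD j y) ↔ _ at h6
  rw [hj] at h5 h6
  have := h5.1 hcy.symm
  have := h6.1 hca.symm
  simp at *
  omega

theorem sevenAntihole_false (hG : ¬ ContainsSevenAntihole G) (f : Fin 7 → V)
    (h : ∀ i j, i < j → (G.Adj (f i) (f j) ↔ ¬ (j.val = i.val + 1 ∨ (i.val = 0 ∧ j.val = 6)))) :
    False := by
  have key : ∀ i j : Fin 7, G.Adj (f i) (f j) ↔ (SimpleGraph.cycleGraph 7)ᶜ.Adj i j := by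
    intro i j
    rw [SimpleGraph.compl_adj, cycleGraph_adj_iff (by norm_num)]
    rcases lt_trichotomy i j with h' | rfl | h'
    · rw [h i j h']
      have := Fin.lt_def.1 h'
      simp only [ne_eq, h'.ne, not_false_eq_true, true_and]
      omega
    · simp
    · rw [G.adj_comm, h j i h']
      have := Fin.lt_def.1 h'
      simp only [ne_eq, h'.ne', not_false_eq_true, true_and]
      omega
  have hinj : Function.Injective f := by
    intro i j hij
    -- Injectivity comes for free: distinct vertices of the antihole have distinct neighbourhoods.
    have h1 : ∀ k, (SimpleGraph.cycleGraph 7)ᶜ.Adj i k ↔ (SimpleGraph.cycleGraph 7)ᶜ.Adj j k :=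
      fun k => by rw [← key, ← key, hij]
    simp only [SimpleGraph.compl_adj, cycleGraph_adj_iff (by norm_num : 3 ≤ 7)] at h1
    clear key h hij
    revert i j
    decide
  exact hG ⟨⟨⟨f, hinj⟩, fun {i j} => key i j⟩⟩

theorem claw_false (hG : IsClawFree G) {v a b c : V} (ha : G.Adj v a) (hb : G.Adj v b)
    (hc : G.Adj v c) (hab : a ≠ b) (hac : a ≠ c) (hbc : b ≠ c) (nab : ¬ G.Adj a b)
    (nac : ¬ G.Adj a c) (nbc : ¬ G.Adj b c) : False := by
  let g : Fin 1 ⊕ Fin 3 → V := Sum.elim (fun _ => v) ![a, b, c]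
  have hinj : Function.Injective g := by
    rintro (i | i) (j | j) h <;> fin_cases i <;> fin_cases j <;>
      simp_all [g, ha.ne, hb.ne, hc.ne, ha.ne', hb.ne', hc.ne']
  have key : ∀ i j, G.Adj (g i) (g j) ↔ (completeBipartiteGraph (Fin 1) (Fin 3)).Adj i j := by
    rintro (i | i) (j | j) <;> fin_cases i <;> fin_cases j <;>
      simp [g, ha, hb, hc, ha.symm, hb.symm, hc.symm, nab, nac, nbc, G.adj_comm b a,
        G.adj_comm c a, G.adj_comm c b]
  exact hG ⟨⟨⟨g, hinj⟩, fun {i j} => key i j⟩⟩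

/-! ### Links: induced paths through a set, attached at their ends -/

/-- `P` is an induced path with vertices in `S`; `a` is adjacent to its first vertex only, and `b` to
its last vertex only. -/
structure Link (G : SimpleGraph V) (S : Set V) (a b : V) (P : List V) : Prop where
  ne : P ≠ []
  ind : IndPath G P
  mem : ∀ z ∈ P, z ∈ S
  left : ∀ z ∈ P, G.Adj a z ↔ P.head? = some z
  right : ∀ z ∈ P, G.Adj b z ↔ P.getLast? = some z

theorem Link.symm {S : Set V} {a b : V} {P : List V} (h : Link G S a b P) :
    Link G S b a P.reverse where
  ne := by simpa using h.ne
  ind := h.ind.reverse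
  mem z hz := h.mem z (List.mem_reverse.1 hz)
  left z hz := by rw [List.head?_reverse]; exact h.right z (List.mem_reverse.1 hz)
  right z hz := by rw [List.getLast?_reverse]; exact h.left z (List.mem_reverse.1 hz)

theorem Link.mono {S T : Set V} {a b : V} {P : List V} (h : Link G S a b P)
    (hT : ∀ z ∈ P, z ∈ T) : Link G T a b P :=
  ⟨h.ne, h.ind, hT, h.left, h.right⟩

theorem getLast?_eq_of_suffix {l l' : List V} (h : l' <:+ l) (hne : l' ≠ []) :
    l'.getLast? = l.getLast? := by
  obtain ⟨t, rfl⟩ := h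
  rw [List.getLast?_append_of_ne_nil _ hne]

/-- One step inside the set `S`. -/
def StepIn (G : SimpleGraph V) (S : Set V) (u v : V) : Prop := G.Adj u v ∧ v ∈ S

/-- The walk is processed from its far end. A new vertex that sees `b` starts afresh; one already on
the path cuts it there; any other is attached to its last neighbour on the path. -/
theorem exists_indPath {S : Set V} {b s t : V} (hs : s ∈ S) (hb : G.Adj b t)
    (h : Relation.ReflTransGen (StepIn G S) s t) :
    ∃ R, IndPath G (s :: R) ∧ (∀ z ∈ s :: R, z ∈ S) ∧
      ∀ z ∈ s :: R, G.Adj b z ↔ (s :: R).getLast? = some z := by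
  induction h using Relation.ReflTransGen.head_induction_on with
  | refl => exact ⟨[], by simp [IndPath], by simpa using hs, by simpa using hb⟩
  | @head s s' h1 _ ih =>
    obtain ⟨Q, hQ, hQS, hQb⟩ := ih h1.2
    by_cases hsb : G.Adj b s
    · exact ⟨[], by simp [IndPath], by simpa using hs, by simpa using hsb⟩
    by_cases hsQ : s ∈ s' :: Q
    · obtain ⟨z, l', h2, rfl, -⟩ := exists_suffix (fun z => z = s) ⟨s, hsQ, rfl⟩
      refine ⟨l', hQ.suffix h2, fun w hw => hQS w (h2.subset hw), fun w hw => ?_⟩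
      rw [hQb w (h2.subset hw), getLast?_eq_of_suffix h2 (List.cons_ne_nil _ _)]
    · obtain ⟨z, l', h2, h3, h4⟩ := exists_suffix (fun z => G.Adj s z) ⟨s', List.mem_cons_self (l := Q), h1.1⟩
      have h5 : (s :: z :: l').getLast? = (s' :: Q).getLast? := by
        rw [List.getLast?_cons_cons]
        exact getLast?_eq_of_suffix h2 (List.cons_ne_nil _ _)
      have hsub : ∀ w ∈ z :: l', w ∈ s' :: Q := fun w hw => h2.subset hw
      refine ⟨z :: l', ⟨fun w hw => ⟨fun e => hsQ (e ▸ hsub w hw), ?_⟩, hQ.suffix h2⟩, ?_, ?_⟩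
      · rcases List.mem_cons.1 hw with rfl | hw'
        · simpa using h3
        · have := (hQ.suffix h2).1 w hw'
          simp [h4 w hw', this.1]
      · intro w hw
        rcases List.mem_cons.1 hw with rfl | hw
        · exact hs
        · exact hQS w (hsub w hw)
      · intro w hw
        rw [h5]
        rcases List.mem_cons.1 hw with rfl | hw
        · simp only [hsb, false_iff]
          exact fun h => hsQ (List.mem_of_getLast? h)
        · exact hQb w (hsub w hw)

/-- Cutting the path at the last neighbour of `a` leaves `a` adjacent to the first vertex only and
does not disturb the end at `b`. -/
theorem exists_link {S : Set V} {a b s t : V} (hs : s ∈ S) (ha : G.Adj a s) (hb : G.Adj b t)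
    (h : Relation.ReflTransGen (StepIn G S) s t) : ∃ P, Link G S a b P := by
  obtain ⟨Q, hQ, hQS, hQb⟩ := exists_indPath hs hb h
  obtain ⟨z, l', h2, h3, h4⟩ := exists_suffix (fun z => G.Adj a z) ⟨s, List.mem_cons_self (l := Q), ha⟩
  refine ⟨z :: l', by simp, hQ.suffix h2, fun w hw => hQS w (h2.subset hw), fun w hw => ?_,
    fun w hw => ?_⟩
  · rcases List.mem_cons.1 hw with rfl | hw'
    · simpa using h3
    · have := (hQ.suffix h2).1 w hw'
      simp [h4 w hw', this.1]
  · rw [hQb w (h2.subset hw), getLast?_eq_of_suffix h2 (List.cons_ne_nil _ _)]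

theorem Link.jewel (hG : IsClean G) {S : Set V} {a b y p c : V} {R : List V}
    (h : Link G S a b (p :: R)) (hne : ∀ z ∈ p :: R, a ≠ z ∧ b ≠ z ∧ y ≠ z ∧ ¬ G.Adj y z)
    (hya : G.Adj y a) (hyb : G.Adj y b) (hab : a ≠ b)
    (hab' : ¬ G.Adj a b) (hcb : G.Adj c b) (hcy : G.Adj c y) (hca : G.Adj c a) (hcp : G.Adj c p)
    (hc : ∀ z ∈ R, ¬ G.Adj c z) : False :=
  jewel_false hG.2.1 h.ind
    (fun z hz => ⟨(hne z hz).1, by simpa [eq_comm] using h.left z hz⟩)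
    (fun z hz => ⟨(hne z hz).2.1, h.right z hz⟩)
    (fun z hz => (hne z hz).2.2) hya hyb hab hab' hcb hcy hca hcp hc

theorem claw (hG : IsClean G) {v a b c : V} (ha : G.Adj v a) (hb : G.Adj v b)
    (hc : G.Adj v c) (hab : a ≠ b) (hac : a ≠ c) (hbc : b ≠ c) :
    G.Adj a b ∨ G.Adj a c ∨ G.Adj b c := by
  by_contra h
  push Not at h
  exact claw_false hG.1 ha hb hc hab hac hbc h.1 h.2.1 h.2.2

/-! ### Frames, and how a member of `N` meets a link -/

/-- A vertex `y`, a set `N` of neighbours of `y`, and a connected set `X` of nonneighbours of `y` in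
which every member of `N` has a neighbour. -/
structure Frame (G : SimpleGraph V) (y : V) (N X : Set V) : Prop where
  adj : ∀ n ∈ N, G.Adj y n
  anti : ∀ x ∈ X, y ≠ x ∧ ¬ G.Adj y x
  conn : ∀ s ∈ X, ∀ t ∈ X, Relation.ReflTransGen (StepIn G X) s t
  nbr : ∀ n ∈ N, ∃ x ∈ X, G.Adj n x

namespace Frame
variable {y : V} {N X : Set V}

theorem ne (F : Frame G y N X) {n x : V} (hn : n ∈ N) (hx : x ∈ X) : n ≠ x := by
  rintro rfl
  exact (F.anti _ hx).2 (F.adj _ hn)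

/-- Two nonadjacent neighbours of `n` in `X` would form a claw at `n` together with `y`. -/
theorem clique (F : Frame G y N X) (hG : IsClean G) {n x x' : V} (hn : n ∈ N) (hx : x ∈ X)
    (hx' : x' ∈ X) (h : G.Adj n x) (h' : G.Adj n x') (hne : x ≠ x') : G.Adj x x' := by
  have h1 := F.anti x hx
  have h2 := F.anti x' hx'
  rcases claw hG (F.adj n hn).symm h h' h1.1 h2.1 hne with h | h | h
  · exact absurd h h1.2
  · exact absurd h h2.2
  · exact h

theorem link (F : Frame G y N X) {a b : V} (ha : a ∈ N) (hb : b ∈ N) : ∃ P, Link G X a b P := by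
  obtain ⟨s, hs, has⟩ := F.nbr a ha
  obtain ⟨t, ht, hbt⟩ := F.nbr b hb
  exact exists_link hs has hbt (F.conn s hs t ht)

/-- Otherwise `c` is complete to the hole `b, y, a, z`, which is a jewel on a hole of length four.
-/
theorem four_wheel (F : Frame G y N X) (hG : IsClean G) {a b c z : V} (ha : a ∈ N) (hb : b ∈ N)
    (hc : c ∈ N) (hz : z ∈ X) (hab : a ≠ b) (nab : ¬ G.Adj a b) (hca : G.Adj c a)
    (hcb : G.Adj c b) (haz : G.Adj a z) (hbz : G.Adj b z) : ¬ G.Adj c z := by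
  intro hcz
  have hP : Link G X a b [z] :=
    ⟨by simp, by simp [IndPath], by simpa using hz, by simpa using haz, by simpa using hbz⟩
  refine hP.jewel hG (y := y) (c := c) ?_ (F.adj a ha) (F.adj b hb) hab nab hcb (F.adj c hc).symm
    hca hcz (by simp)
  simp [haz.ne, hbz.ne, F.anti z hz]

/-- The neighbours of `c` in `X` form a clique, so on the path they can only be `p` and its
successor. If `p` is the only one, the hole through `y` and the path makes a jewel with `c`. If the
successor is one too, the claw at `c` with leaves `a`, `b` and this successor forces it to be the
end of the path. -/
theorem touch_head (F : Frame G y N X) (hG : IsClean G) {a b c p : V} {R : List V} (ha : a ∈ N)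
    (hb : b ∈ N) (hc : c ∈ N) (hab : a ≠ b) (nab : ¬ G.Adj a b) (hca : G.Adj c a)
    (hcb : G.Adj c b) (hP : Link G X a b (p :: R)) (hcp : G.Adj c p) :
    ∃ p', R = [p'] ∧ G.Adj c p' := by
  cases R with
  | nil =>
    have h1 := hP.left p (by simp)
    have h2 := hP.right p (by simp)
    simp only [List.head?_cons, List.getLast?_singleton, iff_true] at h1 h2
    exact absurd hcp (F.four_wheel hG ha hb hc (hP.mem p (by simp)) hab nab hca hcb h1 h2)
  | cons q R =>
    have hX : ∀ z ∈ p :: q :: R, z ∈ X := hP.mem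
    have hR : ∀ z ∈ R, ¬ G.Adj c z := by
      intro z hz hcz
      have h1 := hP.ind.1 z (by simp [hz])
      have h2 := F.clique hG hc (hX p (by simp)) (hX z (by simp [hz])) hcp hcz h1.1
      have h3 := h1.2.1 h2
      simp only [List.head?_cons, Option.some.injEq] at h3
      exact (hP.ind.2.1 z hz).1 h3
    by_cases hcq : G.Adj c q
    · refine ⟨q, ?_, hcq⟩
      have hpq := hP.ind.1 q (by simp)
      have haq : ¬ G.Adj a q := by
        rw [hP.left q (by simp)]
        simpa using hpq.1
      have hqX := hX q (by simp)
      rcases claw hG hca hcb hcq hab (F.ne ha hqX) (F.ne hb hqX) with h | h | h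
      · exact absurd h nab
      · exact absurd h haq
      · rw [hP.right q (by simp), List.getLast?_cons_cons] at h
        cases R with
        | nil => rfl
        | cons r R =>
          rw [List.getLast?_cons_cons] at h
          exact absurd rfl (hP.ind.2.1 q (List.mem_of_getLast? h)).1
    · exfalso
      refine hP.jewel hG (y := y) (c := c) (fun z hz => ?_) (F.adj a ha) (F.adj b hb) hab nab hcb
        (F.adj c hc).symm hca hcp (fun z hz => ?_)
      · exact ⟨F.ne ha (hX z hz), F.ne hb (hX z hz), F.anti z (hX z hz)⟩
      · rcases List.mem_cons.1 hz with rfl | hz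
        · exact hcq
        · exact hR z hz

/-- Excluding the claw at `c` with leaves `a`, `b`, `z` shows that `z` is an end of the link; up to
reversal this is `touch_head`. -/
theorem touch (F : Frame G y N X) (hG : IsClean G) {a b c z : V} {P : List V} (ha : a ∈ N)
    (hb : b ∈ N) (hc : c ∈ N) (hab : a ≠ b) (nab : ¬ G.Adj a b) (hca : G.Adj c a)
    (hcb : G.Adj c b) (hP : Link G X a b P) (hz : z ∈ P) (hcz : G.Adj c z) :
    ∃ p q, P = [p, q] ∧ G.Adj c p ∧ G.Adj c q := by
  have hzX := hP.mem z hz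
  rcases claw hG hca hcb hcz hab (F.ne ha hzX) (F.ne hb hzX) with h | h | h
  · exact absurd h nab
  · rw [hP.left z hz] at h
    obtain ⟨R, rfl⟩ : ∃ R, P = z :: R := by
      cases P with
      | nil => simp at h
      | cons x R => exact ⟨R, by simpa using h⟩
    obtain ⟨p', rfl, hp'⟩ := F.touch_head hG ha hb hc hab nab hca hcb hP hcz
    exact ⟨z, p', rfl, hcz, hp'⟩
  · rw [hP.right z hz, ← List.head?_reverse] at h
    have hP' := hP.symm
    obtain ⟨R, hR⟩ : ∃ R, P.reverse = z :: R := by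
      cases hr : P.reverse with
      | nil => simp [hr] at h
      | cons x R => exact ⟨R, by simpa [hr] using h⟩
    rw [hR] at hP'
    obtain ⟨p', rfl, hp'⟩ :=
      F.touch_head hG hb ha hc hab.symm (fun h => nab h.symm) hcb hca hP' hcz
    refine ⟨p', z, ?_, hp', hcz⟩
    rw [← P.reverse_reverse, hR]; rfl

/-- A neighbour of `c` beyond the first vertex would, by claw-freeness, come with an adjacent one on
the path, and `c` has no others there because its neighbours in `X` form a clique. The two
consecutive neighbours yield a jewel or a line wheel on the hole formed by `y`, `a`, the path and
`b`. -/
theorem touch_of_not_adj (F : Frame G y N X) (hG : IsClean G) {a b c z : V} {P : List V}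
    (ha : a ∈ N) (hb : b ∈ N) (hc : c ∈ N) (hab : a ≠ b) (nab : ¬ G.Adj a b) (hca : G.Adj c a)
    (hcb : ¬ G.Adj c b) (hP : Link G X a b P) (hz : z ∈ P) (hcz : G.Adj c z) :
    P.head? = some z := by
  have hX := hP.mem
  have hcb' : c ≠ b := by rintro rfl; exact nab hca.symm
  have hidx : ∀ i (h : i < P.length), P[i] ∈ P := fun i h => List.getElem_mem h
  have hcl : ∀ i j (hi : i < P.length) (hj : j < P.length), i < j → G.Adj c P[i] → G.Adj c P[j] →
      j = i + 1 := fun i j hi hj hij h1 h2 => by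
    have h3 := hP.ind.getElem hij hj
    exact h3.2.1 (F.clique hG hc (hX _ (hidx i hi)) (hX _ (hidx j hj)) h1 h2 h3.1)
  obtain ⟨i, hi, rfl⟩ := List.getElem_of_mem hz
  by_contra hh
  have hi0 : 0 < i := by
    rcases Nat.eq_zero_or_pos i with rfl | h
    · exact absurd (by rw [List.head?_eq_getElem?, List.getElem?_eq_getElem hi]) hh
    · exact h
  -- If the predecessor of `P[i]` is not a neighbour of `c`, the claw at `P[i]` with leaves `c`, the
  -- predecessor and the successor makes the successor one; at the end of the path `b` replaces the
  -- successor, which is contradictory.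
  obtain ⟨i, hi', h1, h2⟩ :
      ∃ i, ∃ h : i + 1 < P.length, G.Adj c P[i] ∧ G.Adj c P[i + 1] := by
    have hpr := hP.ind.getElem (i := i - 1) (j := i) (by omega) hi
    have hpr' : G.Adj P[i] P[i - 1] := (hpr.2.2 (by omega)).symm
    by_cases hpc : G.Adj c P[i - 1]
    · refine ⟨i - 1, by omega, hpc, ?_⟩
      simpa [Nat.sub_add_cancel hi0] using hcz
    have hc1 := F.ne hc (hX _ (hidx (i - 1) (by omega)))
    rcases Nat.lt_or_ge (i + 1) P.length with hlt | hge
    · have hnx := hP.ind.getElem (i := i) (j := i + 1) (by omega) hlt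
      have hnn := hP.ind.getElem (i := i - 1) (j := i + 1) (by omega) hlt
      refine ⟨i, hlt, hcz, ?_⟩
      rcases claw hG hcz.symm hpr' (hnx.2.2 rfl) hc1 (F.ne hc (hX _ (hidx _ hlt))) hnn.1
        with h | h | h
      · exact absurd h hpc
      · exact h
      · have := hnn.2.1 h; omega
    · exfalso
      have hlast : P.getLast? = some P[i] := by
        rw [List.getLast?_eq_getElem?, List.getElem?_eq_getElem (by omega)]
        congr 2; omega
      have hbi := (hP.right _ (hidx i hi)).2 hlast
      have hb1 := F.ne hb (hX _ (hidx (i - 1) (by omega)))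
      have hbn : ¬ G.Adj b P[i - 1] := by
        rw [hP.right _ (hidx (i - 1) (by omega)), hlast]
        simpa using hpr.1.symm
      rcases claw hG hcz.symm hpr' hbi.symm hc1 hcb' hb1.symm with h | h | h
      · exact hpc h
      · exact hcb h
      · exact hbn h.symm
  have hall : ∀ j (hj : j < P.length), G.Adj c P[j] ↔ j = i ∨ j = i + 1 := by
    intro j hj
    constructor
    · intro h
      rcases lt_trichotomy j i with hji | hji | hji
      · have := hcl j (i + 1) hj hi' (by omega) h h2; omega
      · exact Or.inl hji
      · exact Or.inr (hcl i j (by omega) hj hji h1 h)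
    · rintro (rfl | rfl)
      exacts [h1, h2]
  -- If the two neighbours are the first two vertices, `c` sees four consecutive vertices `y, a, p,
  -- q` of the hole: a jewel. Otherwise it sees two disjoint edges: a line wheel.
  rcases Nat.eq_zero_or_pos i with rfl | hpos
  · obtain ⟨p, q, R, rfl⟩ : ∃ p q R, P = p :: q :: R := by
      match P, hi' with
      | p :: q :: R, _ => exact ⟨p, q, R, rfl⟩
    have hind : IndPath G ((q :: R) ++ [b]) := hP.ind.2.snoc fun w hw => by
      have hw' : w ∈ p :: q :: R := List.mem_cons_of_mem _ hw
      refine ⟨(F.ne hb (hX w hw')).symm, ?_⟩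
      rw [G.adj_comm, hP.right w hw', List.getLast?_cons_cons]
    have hpb : ¬ G.Adj p b := by
      rw [G.adj_comm, hP.right p (by simp), List.getLast?_cons_cons]
      exact fun h => (hP.ind.1 p (List.mem_of_getLast? h)).1 rfl
    refine jewel_false hG.2.1 (b := y) (y := a) (a := p) (p := q) (R := R ++ [b]) (c := c) hind
      ?_ ?_ ?_ ((hP.left p (by simp)).2 rfl) (F.adj a ha).symm (F.anti p (hX p (by simp))).1.symm
      (fun h => (F.anti p (hX p (by simp))).2 h.symm) (F.adj c hc).symm hca h1 h2 ?_
    · intro w hw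
      rw [← List.cons_append, List.mem_append, List.mem_singleton] at hw
      rcases hw with hw | rfl
      · simpa [eq_comm] using hP.ind.1 w hw
      · have hqb := (F.ne hb (hX q (by simp)))
        exact ⟨(F.ne hb (hX p (by simp))).symm, iff_of_false hpb hqb⟩
    · intro w hw
      rw [← List.cons_append, List.mem_append, List.mem_singleton] at hw
      rw [← List.cons_append, List.getLast?_append]
      rcases hw with hw | rfl
      · have hwX := hX w (List.mem_cons_of_mem _ hw)
        have h5 := F.anti w hwX
        have h6 := F.ne hb hwX
        simp [h5, h6]
      · simp [F.adj _ hb, (F.adj _ hb).ne]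
    · intro w hw
      rw [← List.cons_append, List.mem_append, List.mem_singleton] at hw
      rcases hw with hw | rfl
      · have hw' := List.mem_cons_of_mem p hw
        refine ⟨F.ne ha (hX w hw'), ?_⟩
        rw [hP.left w hw']
        simpa using (hP.ind.1 w hw).1
      · exact ⟨hab, nab⟩
    · intro w hw
      rw [List.mem_append, List.mem_singleton] at hw
      rcases hw with hw | rfl
      · obtain ⟨j, hj, rfl⟩ := List.getElem_of_mem hw
        have := hall (j + 2) (by simpa using hj)
        simp only [List.getElem_cons_succ] at this
        rw [this]; omega
      · exact hcb
  · exact lineWheel_false hG.2.2.1 hP.ind (fun w hw => ⟨F.ne ha (hX w hw), hP.left w hw⟩)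
      (fun w hw => ⟨F.ne hb (hX w hw), hP.right w hw⟩) (fun w hw => F.anti w (hX w hw))
      (F.adj a ha) (F.adj b hb) hab nab hcb (F.adj c hc).symm hca hpos hi' hall

end Frame

/-! ### Extending and shortening links -/

theorem Link.head {S : Set V} {a b p : V} {R : List V} (h : Link G S a b (p :: R)) :
    G.Adj a p ∧ ∀ w ∈ R, ¬ G.Adj a w := by
  refine ⟨(h.left p (by simp)).2 rfl, fun w hw => ?_⟩
  rw [h.left w (by simp [hw])]
  simpa using (h.ind.1 w hw).1

theorem Link.cons {S : Set V} {a b p q : V} {R : List V} (h : Link G S q b R) (hp : p ∈ S)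
    (hq : ∀ z ∈ R, p ≠ z ∧ (G.Adj p z ↔ R.head? = some z)) (hap : G.Adj a p) (hbp : ¬ G.Adj b p)
    (ha : ∀ z ∈ R, ¬ G.Adj a z) : Link G S a b (p :: R) where
  ne := by simp
  ind := ⟨hq, h.ind⟩
  mem z hz := by
    rcases List.mem_cons.1 hz with rfl | hz
    exacts [hp, h.mem z hz]
  left z hz := by
    rcases List.mem_cons.1 hz with rfl | hz
    · simpa using hap
    · simp [ha z hz, (hq z hz).1]
  right z hz := by
    have h1 : (p :: R).getLast? = R.getLast? := by
      cases R with
      | nil => exact absurd rfl h.ne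
      | cons => exact List.getLast?_cons_cons
    rw [h1]
    rcases List.mem_cons.1 hz with rfl | hz
    · simp only [hbp, false_iff]
      exact fun h => (hq z (List.mem_of_getLast? h)).1 rfl
    · exact h.right z hz

theorem Link.two {S : Set V} {a b p q : V} (hp : p ∈ S) (hq : q ∈ S) (hpq : G.Adj p q)
    (hap : G.Adj a p) (haq : ¬ G.Adj a q) (hbq : G.Adj b q) (hbp : ¬ G.Adj b p) :
    Link G S a b [p, q] where
  ne := by simp
  ind := by simp [IndPath, hpq, hpq.ne]
  mem := by simp [hp, hq]
  left := by simp [hap, haq, hpq.ne]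
  right := by simp [hbq, hbp, hpq.ne']

/-- A vertex `p` with a neighbour on a link other than its first vertex gives a shorter link. -/
theorem Link.shortcut {S : Set V} {a b h p : V} {R : List V} (hP : Link G S a b (h :: R))
    (hp : p ∈ S) (hpP : p ∉ R) (hap : G.Adj a p) (hbp : ¬ G.Adj b p)
    (hw : ∃ w ∈ R, G.Adj p w) : ∃ L, L ≠ [] ∧ L <:+ R ∧ Link G S a b (p :: L) := by
  obtain ⟨z, l, hl, hz, hl'⟩ := exists_suffix (fun w => G.Adj p w) hw
  have hsub : ∀ w ∈ z :: l, w ∈ h :: R := fun w hw => List.mem_cons_of_mem _ (hl.subset hw)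
  have hind := hP.ind.2.suffix hl
  have hlink : Link G S p b (z :: l) := by
    refine ⟨by simp, hind, fun w hw => hP.mem w (hsub w hw), fun w hw => ?_, fun w hw => ?_⟩
    · rcases List.mem_cons.1 hw with rfl | hw
      · simpa using hz
      · simp [hl' w hw, (hind.1 w hw).1]
    · rw [hP.right w (hsub w hw),
        getLast?_eq_of_suffix (hl.trans (List.suffix_cons _ _)) (List.cons_ne_nil _ _)]
  refine ⟨z :: l, by simp, hl, hlink.cons hp (fun w hw => ⟨?_, hlink.left w hw⟩) hap hbp ?_⟩
  · rintro rfl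
    exact hpP (hl.subset hw)
  · exact fun w hw => hP.head.2 w (hl.subset hw)

/-! ### There is no induced four-vertex path in `N` -/

namespace Frame
variable {y : V} {N X : Set V}

/-- If `c` misses the link `P` but sees `p`, then `p` is adjacent to the first vertex of `P` only. -/
theorem adj_iff_head (F : Frame G y N X) (hG : IsClean G) {a b c p : V} {P : List V} (ha : a ∈ N)
    (hb : b ∈ N) (hc : c ∈ N) (hab : a ≠ b) (nab : ¬ G.Adj a b) (hca : G.Adj c a)
    (hcb : G.Adj c b) (hP : Link G X a b P) (hcP : ∀ z ∈ P, ¬ G.Adj c z) (hp : p ∈ X)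
    (hcp : G.Adj c p) (hap : G.Adj a p) (hbp : ¬ G.Adj b p) :
    ∀ z ∈ P, G.Adj p z ↔ P.head? = some z := by
  have hpP : p ∉ P := fun h => hcP p h hcp
  cases P with
  | nil => simp
  | cons h R =>
    have hhX := hP.mem h (by simp)
    have hph : G.Adj p h := F.clique hG ha hp hhX hap hP.head.1 (by rintro rfl; simp at hpP)
    have hR : ∀ w ∈ R, ¬ G.Adj p w := by
      intro w hw hpw
      -- The shortcut through `p` is a link that `c` touches, so by `touch` its second vertex is a
      -- neighbour of `c`; but that vertex lies on the original link.
      obtain ⟨L, -, hL, hQ⟩ := hP.shortcut hp (fun h => hpP (by simp [h])) hap hbp ⟨w, hw, hpw⟩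
      obtain ⟨p', q', he, -, hq⟩ := F.touch hG ha hb hc hab nab hca hcb hQ (z := p) (by simp) hcp
      have hLq : L = [q'] := by simpa using (List.cons.inj he).2
      exact hcP q' (by simp [hL.subset (hLq ▸ List.mem_singleton_self q' : q' ∈ L)]) hq
    intro z hz
    rcases List.mem_cons.1 hz with rfl | hz
    · simpa using hph
    · simp [hR z hz, (hP.ind.1 z hz).1]

/-- A common neighbour of `a` and `b` that sees one link between them sees every one. -/
theorem touch_all (F : Frame G y N X) (hG : IsClean G) {a b c : V} {P Q : List V} (ha : a ∈ N)
    (hb : b ∈ N) (hc : c ∈ N) (hab : a ≠ b) (nab : ¬ G.Adj a b) (hca : G.Adj c a)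
    (hcb : G.Adj c b) (hQ : Link G X a b Q) (hcQ : ∃ z ∈ Q, G.Adj c z) (hP : Link G X a b P) :
    ∃ p q, P = [p, q] ∧ G.Adj c p ∧ G.Adj c q := by
  obtain ⟨z, hz, hcz⟩ := hcQ
  obtain ⟨p, q, rfl, hp, hq⟩ := F.touch hG ha hb hc hab nab hca hcb hQ hz hcz
  by_cases hcP : ∃ z ∈ P, G.Adj c z
  · obtain ⟨z, hz, hcz⟩ := hcP
    exact F.touch hG ha hb hc hab nab hca hcb hP hz hcz
  exfalso
  push Not at hcP
  have hpX := hQ.mem p (by simp)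
  have hqX := hQ.mem q (by simp)
  have hpq := hQ.ind.1 q (by simp)
  have hap := hQ.head.1
  have haq := hQ.head.2 q (by simp)
  have hbq : G.Adj b q := (hQ.right q (by simp)).2 rfl
  have hbp : ¬ G.Adj b p := by
    rw [hQ.right p (by simp)]
    simpa using hpq.1.symm
  have h1 := F.adj_iff_head hG ha hb hc hab nab hca hcb hP hcP hpX hp hap hbp
  have h2 := F.adj_iff_head hG hb ha hc hab.symm (fun h => nab h.symm) hcb hca hP.symm
    (fun z hz => hcP z (List.mem_reverse.1 hz)) hqX hq hbq haq
  have hl : Link G X a q P := ⟨hP.ne, hP.ind, hP.mem, hP.left, fun z hz => by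
    rw [h2 z (List.mem_reverse.2 hz), List.head?_reverse]⟩
  cases P with
  | nil => exact hP.ne rfl
  | cons h R =>
    -- Here the hole runs through `c` instead of `y`: it is `q, c, a` followed by `P`, and `p` sees
    -- exactly `q`, `c`, `a` and the first vertex of `P`.
    refine hl.jewel hG (y := c) (c := p) (fun z hz => ⟨F.ne ha (hP.mem z hz), ?_,
      F.ne hc (hP.mem z hz), hcP z hz⟩) hca hq (F.ne ha hqX) haq (hpq.2.2 rfl) hp.symm hap.symm
      ((h1 h (by simp)).2 rfl) (fun z hz => ?_)
    · rintro rfl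
      exact hcP _ hz hq
    · rw [h1 z (by simp [hz])]
      simpa using (hP.ind.1 z hz).1

/-- As `a` can see only the first vertex, the link from `a₀` is also a link from `a`. Then `touch`
makes `b` adjacent to both of its two vertices, whereas `b` may see only the one at the end of `b₀`.
-/
theorem path_not_both (F : Frame G y N X) (hG : IsClean G) {a₀ a b b₀ : V} {P : List V}
    (ha₀ : a₀ ∈ N) (ha : a ∈ N) (hb : b ∈ N) (hb₀ : b₀ ∈ N) (h1 : G.Adj a₀ a) (h2 : G.Adj a b)
    (h3 : G.Adj b b₀) (n1 : ¬ G.Adj a₀ b) (n2 : ¬ G.Adj a₀ b₀) (n3 : ¬ G.Adj a b₀) (hne : a₀ ≠ b₀)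
    (hP : Link G X a₀ b₀ P) (haP : ∃ z ∈ P, G.Adj a z) (hbP : ∃ z ∈ P, G.Adj b z) : False := by
  have hab₀ : a ≠ b₀ := by rintro rfl; exact n2 h1
  obtain ⟨z, hz, haz⟩ := haP
  have hh : ∀ w ∈ P, G.Adj a w → P.head? = some w := fun w hw =>
    F.touch_of_not_adj hG ha₀ hb₀ ha hne n2 h1.symm n3 hP hw
  have hla : Link G X a b₀ P := ⟨hP.ne, hP.ind, hP.mem, fun w hw => ⟨hh w hw, fun h => by
    rw [hh z hz haz] at h
    obtain rfl := Option.some.inj h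
    exact haz⟩, hP.right⟩
  obtain ⟨w, hw, hbw⟩ := hbP
  obtain ⟨p, q, rfl, hp, -⟩ := F.touch hG ha hb₀ hb hab₀ n3 h2.symm h3 hla hw hbw
  have := F.touch_of_not_adj hG hb₀ ha₀ hb hne.symm (fun h => n2 h.symm) h3 (fun h => n1 h.symm)
    hP.symm (z := p) (by simp) hp
  simp at this
  exact (hP.ind.1 q (by simp)).1 this.symm

/-- If neither `a` nor `b` sees the link, then `b₀, b, a, a₀` and the link form a hole, and `y` sees
exactly these four consecutive vertices: a jewel. -/
theorem path_one (F : Frame G y N X) (hG : IsClean G) {a₀ a b b₀ : V} {P : List V}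
    (ha₀ : a₀ ∈ N) (ha : a ∈ N) (hb : b ∈ N) (hb₀ : b₀ ∈ N) (h1 : G.Adj a₀ a) (h2 : G.Adj a b)
    (h3 : G.Adj b b₀) (n1 : ¬ G.Adj a₀ b) (n2 : ¬ G.Adj a₀ b₀) (n3 : ¬ G.Adj a b₀) (hne : a₀ ≠ b₀)
    (hP : Link G X a₀ b₀ P) : (∃ z ∈ P, G.Adj a z) ∨ ∃ z ∈ P, G.Adj b z := by
  by_contra h
  push Not at h
  have hl : Link G Set.univ a b₀ (a₀ :: P) :=
    (hP.mono (T := Set.univ) (by simp)).cons (by simp)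
      (fun z hz => ⟨F.ne ha₀ (hP.mem z hz), hP.left z hz⟩) h1.symm (fun h => n2 h.symm) h.1
  refine hl.jewel hG (y := b) (c := y) (fun z hz => ?_) h2.symm h3 (by rintro rfl; exact n2 h1) n3
    (F.adj _ hb₀) (F.adj _ hb) (F.adj _ ha) (F.adj _ ha₀) (fun z hz => (F.anti z (hP.mem z hz)).2)
  rcases List.mem_cons.1 hz with rfl | hz
  · exact ⟨h1.ne', hne.symm, by rintro rfl; exact n2 h3, fun h => n1 h.symm⟩
  · exact ⟨F.ne ha (hP.mem z hz), F.ne hb₀ (hP.mem z hz), F.ne hb (hP.mem z hz), h.2 z hz⟩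

/-- The only neighbour of `a` on the link is its first vertex `w`. A neighbour `z` of `b` in `X`
lies off the link, and each way of attaching `z` to `a`, `a₀` and the link leads to a forbidden
subgraph or a forbidden link. -/
theorem path_aux (F : Frame G y N X) (hG : IsClean G) {a₀ a b b₀ : V} {P : List V}
    (ha₀ : a₀ ∈ N) (ha : a ∈ N) (hb : b ∈ N) (hb₀ : b₀ ∈ N) (h1 : G.Adj a₀ a) (h2 : G.Adj a b)
    (h3 : G.Adj b b₀) (n1 : ¬ G.Adj a₀ b) (n2 : ¬ G.Adj a₀ b₀) (n3 : ¬ G.Adj a b₀) (hne : a₀ ≠ b₀)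
    (hP : Link G X a₀ b₀ P) (haP : ∃ z ∈ P, G.Adj a z) (hbP : ∀ z ∈ P, ¬ G.Adj b z) : False := by
  have hab₀ : a ≠ b₀ := by rintro rfl; exact n2 h1
  have ha₀b : a₀ ≠ b := by rintro rfl; exact n2 h3
  obtain ⟨w, hw, haw⟩ := haP
  have hh := F.touch_of_not_adj hG ha₀ hb₀ ha hne n2 h1.symm n3 hP hw haw
  obtain ⟨R, rfl⟩ : ∃ R, P = w :: R := by
    cases P with
    | nil => simp at hh
    | cons x R => exact ⟨R, by simpa using hh⟩
  have haR : ∀ z ∈ w :: R, G.Adj a z ↔ (w :: R).head? = some z := fun z hz =>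
    ⟨F.touch_of_not_adj hG ha₀ hb₀ ha hne n2 h1.symm n3 hP hz, fun h => by
      obtain rfl := Option.some.inj h
      exact haw⟩
  have hla : Link G X a b₀ (w :: R) := ⟨hP.ne, hP.ind, hP.mem, haR, hP.right⟩
  have hwX := hP.mem w hw
  obtain ⟨z, hz, hbz⟩ := F.nbr b hb
  have hzP : z ∉ w :: R := fun h => hbP z h hbz
  have hzw : z ≠ w := by rintro rfl; simp at hzP
  by_cases haz : G.Adj a z
  · have nb₀z : ¬ G.Adj b₀ z := fun h =>
      F.four_wheel hG ha hb₀ hb hz hab₀ n3 h2.symm h3 haz h hbz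
    have na₀z : ¬ G.Adj a₀ z := fun h =>
      F.four_wheel hG ha₀ hb ha hz ha₀b n1 h1.symm h2 h hbz haz
    have hzadj := F.adj_iff_head hG ha hb₀ hb hab₀ n3 h2.symm h3 hla hbP hz hbz haz nb₀z
    -- Now `w` is the centre of a claw with leaves `a₀`, `z` and the next vertex of the link, or
    -- `b₀` if there is none.
    have hwz : G.Adj w z := ((hzadj w hw).2 rfl).symm
    have hwa₀ := hP.head.1.symm
    cases R with
    | nil =>
      have hwb₀ : G.Adj b₀ w := (hP.right w hw).2 rfl
      rcases claw hG hwa₀ hwz hwb₀.symm (F.ne ha₀ hz) hne (F.ne hb₀ hz).symm with h | h | h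
      exacts [na₀z h, n2 h, nb₀z h.symm]
    | cons q R =>
      have hwq := hP.ind.1 q (by simp)
      have hqX := hP.mem q (by simp)
      have hzq : z ≠ q := by rintro rfl; simp at hzP
      rcases claw hG hwa₀ hwz (hwq.2.2 rfl) (F.ne ha₀ hz) (F.ne ha₀ hqX) hzq with h | h | h
      · exact na₀z h
      · exact hP.head.2 q (by simp) h
      · rw [hzadj q (by simp)] at h
        exact hwq.1 (by simpa using h)
  · have hb₀z : G.Adj b₀ z := by
      rcases claw hG h2.symm h3 hbz hab₀ (F.ne ha hz) (F.ne hb₀ hz) with h | h | h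
      exacts [absurd h n3, absurd h haz, h]
    by_cases ha₀z : G.Adj a₀ z
    · have hzw' : G.Adj w z := (F.clique hG ha₀ hz hwX ha₀z hP.head.1 hzw).symm
      by_cases hb₀w : G.Adj b₀ w
      -- In this cyclic order the nonadjacent pairs are exactly the consecutive ones.
      · refine sevenAntihole_false hG.2.2.2.2 ![y, w, b, a₀, b₀, a, z] ?_
        have e1 := (F.anti w hwX).2
        have e2 := (F.anti z hz).2
        have e3 := hbP w hw
        intro i j hij
        fin_cases i <;> fin_cases j <;>
          first
          | exact absurd hij (by decide)
          | simp [F.adj _ ha, F.adj _ hb, F.adj _ ha₀, F.adj _ hb₀, h1, h3, n1, n2, n3, e1, e2, e3,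
              haw, haz, hbz, hb₀z, ha₀z, hzw', hb₀w, hP.head.1, h2.symm, G.adj_comm w,
              G.adj_comm b₀ a, G.adj_comm b a₀]
      · have hl := Link.two hwX hz hzw' haw haz hb₀z hb₀w
        obtain ⟨p, q, he, hp, -⟩ :=
          F.touch hG ha hb₀ hb hab₀ n3 h2.symm h3 hl (z := z) (by simp) hbz
        simp at he
        exact hbP w hw (he.1 ▸ hp)
    · have hPr := hP.symm
      obtain ⟨l, L, hlL⟩ : ∃ l L, (w :: R).reverse = l :: L := by
        cases h : (w :: R).reverse with
        | nil => simp at h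
        | cons l L => exact ⟨l, L, rfl⟩
      rw [hlL] at hPr
      have hmem : ∀ v, v ∈ l :: L ↔ v ∈ w :: R := fun v => by rw [← hlL, List.mem_reverse]
      have hlast : (w :: R).getLast? = some l := by rw [← List.head?_reverse, hlL]; rfl
      -- Otherwise rerouting the link through `z` keeps its end `w` and yields a link between `a₀`
      -- and `b₀` seen by both `a` and `b`.
      have hL : ∀ v ∈ L, ¬ G.Adj z v := by
        intro v hv hzv
        obtain ⟨L', hne', hL', hQ⟩ := hPr.shortcut hz
          (fun h => hzP ((hmem z).1 (List.mem_cons_of_mem _ h))) hb₀z ha₀z ⟨v, hv, hzv⟩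
        have hlw : L'.getLast? = some w := by
          rw [getLast?_eq_of_suffix (hL'.trans (List.suffix_cons l L)) hne', ← hlL,
            List.getLast?_reverse]; rfl
        exact F.path_not_both hG ha₀ ha hb hb₀ h1 h2 h3 n1 n2 n3 hne hQ.symm
          ⟨w, by simp [List.mem_of_getLast? hlw], haw⟩ ⟨z, by simp, hbz⟩
      have hzl : G.Adj z l :=
        F.clique hG hb₀ hz (hPr.mem l (by simp)) hb₀z hPr.head.1 (by
          rintro rfl; exact hzP ((hmem z).1 (by simp)))
      have hl : Link G X a₀ b ((w :: R) ++ [z]) := by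
        refine ⟨by simp, hP.ind.snoc fun v hv => ⟨by rintro rfl; exact hzP hv, ?_⟩, ?_, ?_, ?_⟩
        · rw [hlast, G.adj_comm]
          rcases List.mem_cons.1 ((hmem v).2 hv) with rfl | hv'
          · simpa using hzl
          · simp [hL v hv', (hPr.ind.1 v hv').1]
        · intro v hv
          rcases List.mem_append.1 hv with hv | hv
          · exact hP.mem v hv
          · rwa [List.mem_singleton.1 hv]
        · intro v hv
          rcases List.mem_append.1 hv with hv | hv
          · simpa using hP.left v hv
          · rw [List.mem_singleton.1 hv]
            simpa [ha₀z] using hzw.symm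
        · intro v hv
          rw [List.getLast?_append]
          rcases List.mem_append.1 hv with hv | hv
          · have : z ≠ v := by rintro rfl; exact hzP hv
            simp [hbP v hv, this]
          · rw [List.mem_singleton.1 hv]
            simpa using hbz
      -- Appending `z` turns the link into one between `a₀` and `b`; as `a` sees `w` on it, it must
      -- also see the last vertex `z`, which is a contradiction.
      obtain ⟨p, q, he, -, hq⟩ := F.touch hG ha₀ hb ha ha₀b n1 h1.symm h2 hl (z := w) (by simp) haw
      have : q = z := by
        have := congrArg List.getLast? he
        rw [List.getLast?_append] at this
        simpa using this.symm
      exact haz (this ▸ hq)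

/-- `N` contains no induced path with four vertices. -/
theorem no_path (F : Frame G y N X) (hG : IsClean G) {a₀ a b b₀ : V}
    (ha₀ : a₀ ∈ N) (ha : a ∈ N) (hb : b ∈ N) (hb₀ : b₀ ∈ N) (h1 : G.Adj a₀ a) (h2 : G.Adj a b)
    (h3 : G.Adj b b₀) (n1 : ¬ G.Adj a₀ b) (n2 : ¬ G.Adj a₀ b₀) (n3 : ¬ G.Adj a b₀)
    (hne : a₀ ≠ b₀) : False := by
  obtain ⟨P, hP⟩ := F.link ha₀ hb₀
  by_cases haP : ∃ z ∈ P, G.Adj a z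
  · by_cases hbP : ∃ z ∈ P, G.Adj b z
    · exact F.path_not_both hG ha₀ ha hb hb₀ h1 h2 h3 n1 n2 n3 hne hP haP hbP
    · push Not at hbP
      exact F.path_aux hG ha₀ ha hb hb₀ h1 h2 h3 n1 n2 n3 hne hP haP hbP
  · obtain ⟨z, hz, hbz⟩ :=
      (F.path_one hG ha₀ ha hb hb₀ h1 h2 h3 n1 n2 n3 hne hP).resolve_left haP
    push Not at haP
    exact F.path_aux hG hb₀ hb ha ha₀ h3.symm h2.symm h1.symm (fun h => n3 h.symm)
      (fun h => n2 h.symm) (fun h => n1 h.symm) hne.symm hP.symm ⟨z, by simpa using hz, hbz⟩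
      (fun z hz => haP z (by simpa using hz))

end Frame

/-! ### The structure of `N` and its attachment to `X` -/

/-- `N` is the union of cliques `A`, `B`, `U`, where `A` and `B` are anticomplete to each other and
`U` is complete to both. -/
structure Split (G : SimpleGraph V) (N A B U : Set V) : Prop where
  subA : A ⊆ N
  subB : B ⊆ N
  subU : U ⊆ N
  cover : ∀ n ∈ N, n ∈ A ∨ n ∈ B ∨ n ∈ U
  cliqueA : G.IsClique A
  cliqueB : G.IsClique B
  cliqueU : G.IsClique U
  anti : ∀ a ∈ A, ∀ b ∈ B, a ≠ b ∧ ¬ G.Adj a b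
  adjA : ∀ u ∈ U, ∀ a ∈ A, G.Adj u a
  adjB : ∀ u ∈ U, ∀ b ∈ B, G.Adj u b
  neA : A.Nonempty
  neB : B.Nonempty

theorem Split.symm {N A B U : Set V} (h : Split G N A B U) : Split G N B A U where
  subA := h.subB
  subB := h.subA
  subU := h.subU
  cover n hn := by have := h.cover n hn; tauto
  cliqueA := h.cliqueB
  cliqueB := h.cliqueA
  cliqueU := h.cliqueU
  anti b hb a ha := ⟨(h.anti a ha b hb).1.symm, fun h' => (h.anti a ha b hb).2 h'.symm⟩
  adjA := h.adjB
  adjB := h.adjA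
  neA := h.neB
  neB := h.neA

/-- The neighbours of `u` in `X` are adjacent to all of `A` and to none of `B`. -/
def Leans (G : SimpleGraph V) (X A B : Set V) (u : V) : Prop :=
  ∀ x ∈ X, G.Adj u x → (∀ a ∈ A, G.Adj a x) ∧ ∀ b ∈ B, ¬ G.Adj b x

/-- `u` sees a link of length two between every `a ∈ A` and every `b ∈ B`. -/
def Straddles (G : SimpleGraph V) (X A B : Set V) (u : V) : Prop :=
  ∀ a ∈ A, ∀ b ∈ B, ∃ p q, Link G X a b [p, q] ∧ G.Adj u p ∧ G.Adj u q

theorem Straddles.symm {X A B : Set V} {u : V} (h : Straddles G X A B u) : Straddles G X B A u := by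
  intro b hb a ha
  obtain ⟨p, q, hl, hp, hq⟩ := h a ha b hb
  exact ⟨q, p, hl.symm, hq, hp⟩

namespace Frame
variable {y : V} {N X A B U : Set V}

theorem adj_or_adj (F : Frame G y N X) (hG : IsClean G) {a b x : V} (ha : a ∈ N) (hb : b ∈ N)
    (hab : a ≠ b) (nab : ¬ G.Adj a b) {c : V} (hca : G.Adj c a) (hcb : G.Adj c b) (hx : x ∈ X)
    (hcx : G.Adj c x) : G.Adj a x ∨ G.Adj b x := by
  rcases claw hG hca hcb hcx hab (F.ne ha hx) (F.ne hb hx) with h | h | h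
  exacts [absurd h nab, Or.inl h, Or.inr h]

/-- `A` and `B` consist of the nonneighbours of `b` and of `a`, and `U` of their common neighbours.
A stable triple in `N` would be a claw at `y`, so `A` and `B` are cliques; an edge between `A` and
`B`, or a missing edge between `U` and `A ∪ B`, would give an induced four-vertex path. -/
theorem exists_split (F : Frame G y N X) (hG : IsClean G) {a b : V} (ha : a ∈ N) (hb : b ∈ N)
    (hab : a ≠ b) (nab : ¬ G.Adj a b) :
    ∃ A B U, Split G N A B U := by
  have st : ∀ u ∈ N, ∀ v ∈ N, ∀ w ∈ N, u ≠ v → u ≠ w → v ≠ w →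
      G.Adj u v ∨ G.Adj u w ∨ G.Adj v w := fun u hu v hv w hw =>
    claw hG (F.adj u hu) (F.adj v hv) (F.adj w hw)
  have key : ∀ {a b : V}, a ∈ N → b ∈ N → a ≠ b → ¬ G.Adj a b →
      ∀ u ∈ N, G.Adj u a → G.Adj u b → ∀ c ∈ N, c ≠ b → ¬ G.Adj c b → G.Adj u c := by
    intro a b ha hb hab nab u hu hua hub c hc hcb ncb
    by_cases hca : c = a
    · rwa [hca]
    by_contra huc
    have hac : G.Adj a c := by
      rcases st a ha b hb c hc hab (Ne.symm hca) hcb.symm with h | h | h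
      exacts [absurd h nab, h, absurd h.symm ncb]
    exact F.no_path hG hb hu ha hc hub.symm hua hac (fun h => nab h.symm) (fun h => ncb h.symm) huc
      hcb.symm
  have hcl : ∀ {b : V}, b ∈ N → G.IsClique {n | n ∈ N ∧ n ≠ b ∧ ¬ G.Adj n b} := by
    rintro b hb u ⟨hu, hub, nub⟩ v ⟨hv, hvb, nvb⟩ huv
    rcases st u hu v hv b hb huv hub hvb with h | h | h
    exacts [h, absurd h nub, absurd h nvb]
  refine ⟨{n | n ∈ N ∧ n ≠ b ∧ ¬ G.Adj n b}, {n | n ∈ N ∧ n ≠ a ∧ ¬ G.Adj n a},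
    {n | n ∈ N ∧ G.Adj n a ∧ G.Adj n b}, ⟨fun _ h => h.1, fun _ h => h.1, fun _ h => h.1, ?_,
    hcl hb, hcl ha, ?_, ?_, ?_, ?_, ⟨a, ha, hab, nab⟩, ⟨b, hb, hab.symm, fun h => nab h.symm⟩⟩⟩
  · intro n hn
    by_cases h1 : n = a
    · subst h1; exact Or.inl ⟨hn, hab, nab⟩
    by_cases h2 : n = b
    · subst h2; exact Or.inr (Or.inl ⟨hn, h1, fun h => nab h.symm⟩)
    by_cases h3 : G.Adj n a
    · by_cases h4 : G.Adj n b
      · exact Or.inr (Or.inr ⟨hn, h3, h4⟩)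
      · exact Or.inl ⟨hn, h2, h4⟩
    · exact Or.inr (Or.inl ⟨hn, h1, h3⟩)
  · rintro u ⟨hu, hua, hub⟩ v ⟨hv, hva, hvb⟩ huv
    by_contra nuv
    -- Nonadjacent `u`, `v` in `U` form a four-hole with `a` and `b` to which `y` is complete.
    refine jewel_false hG.2.1 (b := u) (y := a) (a := v) (p := b) (R := []) (c := y) (by simp [IndPath])
      ?_ ?_ ?_ hva.symm hua.symm huv.symm (fun h => nuv h.symm) (F.adj u hu) (F.adj a ha)
      (F.adj v hv) (F.adj b hb) (by simp)
    · simp [hvb, hvb.ne]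
    · simp [hub, hub.ne]
    · simp [hab, nab]
  · rintro c ⟨hc, hcb, ncb⟩ d ⟨hd, hda, nda⟩
    have hcd : c ≠ d := by
      rintro rfl
      rcases st a ha b hb c hc hab hda.symm hcb.symm with h | h | h
      exacts [nab h, nda h.symm, ncb h.symm]
    refine ⟨hcd, fun h => ?_⟩
    have hca : c ≠ a := by rintro rfl; exact nda h.symm
    have hdb : d ≠ b := by rintro rfl; exact ncb h
    have hac : G.Adj a c := by
      rcases st a ha b hb c hc hab hca.symm hcb.symm with h | h | h
      exacts [absurd h nab, h, absurd h.symm ncb]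
    have hbd : G.Adj d b := by
      rcases st a ha b hb d hd hab hda.symm hdb.symm with h | h | h
      exacts [absurd h nab, absurd h.symm nda, h.symm]
    exact F.no_path hG ha hc hd hb hac h hbd (fun h => nda h.symm) nab ncb hab
  · rintro u ⟨hu, hua, hub⟩ c ⟨hc, hcb, ncb⟩
    exact key ha hb hab nab u hu hua hub c hc hcb ncb
  · rintro u ⟨hu, hua, hub⟩ c ⟨hc, hca, nca⟩
    exact key hb ha hab.symm (fun h => nab h.symm) u hu hub hua c hc hca nca

theorem not_both (F : Frame G y N X) (hG : IsClean G) (S : Split G N A B U) {u a b x : V}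
    (hu : u ∈ U) (ha : a ∈ A) (hb : b ∈ B) (hx : x ∈ X) (hux : G.Adj u x) (hax : G.Adj a x) :
    ¬ G.Adj b x := fun hbx =>
  F.four_wheel hG (S.subA ha) (S.subB hb) (S.subU hu) hx (S.anti a ha b hb).1 (S.anti a ha b hb).2
    (S.adjA u hu a ha) (S.adjB u hu b hb) hax hbx hux

theorem split_adj_or_adj (F : Frame G y N X) (hG : IsClean G) (S : Split G N A B U) {u a b x : V}
    (hu : u ∈ U) (ha : a ∈ A) (hb : b ∈ B) (hx : x ∈ X) (hux : G.Adj u x) :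
    G.Adj a x ∨ G.Adj b x :=
  F.adj_or_adj hG (S.subA ha) (S.subB hb) (S.anti a ha b hb).1 (S.anti a ha b hb).2
    (S.adjA u hu a ha) (S.adjB u hu b hb) hx hux

theorem split_touch (F : Frame G y N X) (hG : IsClean G) (S : Split G N A B U) {u a b z : V}
    {P : List V} (hu : u ∈ U) (ha : a ∈ A) (hb : b ∈ B) (hP : Link G X a b P) (hz : z ∈ P)
    (huz : G.Adj u z) : ∃ p q, P = [p, q] ∧ G.Adj u p ∧ G.Adj u q :=
  F.touch hG (S.subA ha) (S.subB hb) (S.subU hu) (S.anti a ha b hb).1 (S.anti a ha b hb).2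
    (S.adjA u hu a ha) (S.adjB u hu b hb) hP hz huz

theorem link_two (F : Frame G y N X) (hG : IsClean G) (S : Split G N A B U) {u a b p q : V}
    (hu : u ∈ U) (ha : a ∈ A) (hb : b ∈ B) (hp : p ∈ X) (hq : q ∈ X) (hup : G.Adj u p)
    (huq : G.Adj u q) (hap : G.Adj a p) (hbq : G.Adj b q) : Link G X a b [p, q] := by
  have hbp := F.not_both hG S hu ha hb hp hup hap
  have haq := F.not_both hG S.symm hu hb ha hq huq hbq
  exact Link.two hp hq (F.clique hG (S.subU hu) hp hq hup huq (by rintro rfl; exact haq hap)) hap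
    haq hbq hbp

/-- A neighbour of `u` in `X` sees exactly one of any `a ∈ A`, `b ∈ B`. So a single `a` sharing no
neighbour in `X` with `u` pushes all of them to the side of `B`, and symmetrically. If there is no
such vertex on either side, a neighbour shared with `a` and one shared with `b` form a link. -/
theorem trichotomy (F : Frame G y N X) (hG : IsClean G) (S : Split G N A B U) {u : V}
    (hu : u ∈ U) : Leans G X A B u ∨ Leans G X B A u ∨ Straddles G X A B u := by
  have key : ∀ {A B : Set V}, Split G N A B U →
      (∃ a ∈ A, ∀ x ∈ X, G.Adj u x → ¬ G.Adj a x) → Leans G X B A u := by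
    rintro A B S ⟨a, ha, h⟩ x hx hux
    have hB : ∀ b ∈ B, G.Adj b x := fun b hb =>
      (F.split_adj_or_adj hG S hu ha hb hx hux).resolve_left (h x hx hux)
    obtain ⟨b, hb⟩ := S.neB
    exact ⟨hB, fun a' ha' h' => F.not_both hG S hu ha' hb hx hux h' (hB b hb)⟩
  by_cases h1 : ∃ a ∈ A, ∀ x ∈ X, G.Adj u x → ¬ G.Adj a x
  · exact Or.inr (Or.inl (key S h1))
  by_cases h2 : ∃ b ∈ B, ∀ x ∈ X, G.Adj u x → ¬ G.Adj b x
  · exact Or.inl (key S.symm h2)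
  push Not at h1 h2
  refine Or.inr (Or.inr fun a ha b hb => ?_)
  obtain ⟨p, hp, hup, hap⟩ := h1 a ha
  obtain ⟨q, hq, huq, hbq⟩ := h2 b hb
  exact ⟨p, q, F.link_two hG S hu ha hb hp hq hup huq hap hbq, hup, huq⟩

/-- Since `u` leans to `A`, `a` sees the first vertex. Its neighbours in `X` form a clique, so only
the second vertex could be another one on the path; in that case `a` would see four consecutive
vertices of the hole formed by `u'`, `u` and the path. -/
theorem leans_link (F : Frame G y N X) (hG : IsClean G) (S : Split G N A B U) {u u' a : V}
    {P : List V} (hu : u ∈ U) (hu' : u' ∈ U) (huu : u ≠ u') (ha : a ∈ A) (h : Leans G X A B u)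
    (h' : Leans G X B A u') (hP : Link G X u u' P) : ∀ z ∈ P, G.Adj a z ↔ P.head? = some z := by
  have haN := S.subA ha
  cases P with
  | nil => simp
  | cons m R =>
    have hmX := hP.mem m (by simp)
    have ham := (h m hmX hP.head.1).1 a ha
    have hR : ∀ z ∈ R, ¬ G.Adj a z := by
      cases R with
      | nil => simp
      | cons z R =>
        have hzX := hP.mem z (by simp)
        have hz : ¬ G.Adj a z → ∀ w ∈ z :: R, ¬ G.Adj a w := by
          intro haz w hw haw
          have h1 := hP.ind.1 w hw
          have h2 := F.clique hG haN hmX (hP.mem w (List.mem_cons_of_mem _ hw)) ham haw h1.1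
          rw [h1.2] at h2
          simp at h2
          exact haz (h2 ▸ haw)
        by_cases haz : G.Adj a z
        · exfalso
          have hl : Link G X m u' (z :: R) := by
            refine ⟨by simp, hP.ind.2, fun w hw => hP.mem w (List.mem_cons_of_mem _ hw),
              fun w hw => (hP.ind.1 w hw).2, fun w hw => ?_⟩
            rw [hP.right w (List.mem_cons_of_mem _ hw), List.getLast?_cons_cons]
          have hmu' : ¬ G.Adj u' m := fun hc => (h' m hmX hc).2 a ha ham
          refine hl.jewel hG (y := u) (c := a) (fun w hw => ?_) hP.head.1
            (S.cliqueU hu hu' huu) (F.ne (S.subU hu') hmX).symm (fun h => hmu' h.symm)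
            (S.adjA u' hu' a ha).symm (S.adjA u hu a ha).symm ham haz (fun w hw haw => ?_)
          · have hwX := hP.mem w (List.mem_cons_of_mem _ hw)
            exact ⟨(hP.ind.1 w hw).1, F.ne (S.subU hu') hwX, F.ne (S.subU hu) hwX,
              hP.head.2 w hw⟩
          · have h1 := hP.ind.1 w (by simp [hw])
            have h2 := F.clique hG haN hmX (hP.mem w (by simp [hw])) ham haw h1.1
            rw [h1.2] at h2
            simp at h2
            exact (hP.ind.2.1 w hw).1 h2
        · exact hz haz
    intro z hz
    rcases List.mem_cons.1 hz with rfl | hz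
    · simpa using ham
    · simp [hR z hz, (hP.ind.1 z hz).1]

/-- By `leans_link` at both ends, a link between `u` and `u'` is also one between `a` and `b`. As
`u` touches it, `split_touch` gives `u` a second neighbour on it. -/
theorem not_leans_leans (F : Frame G y N X) (hG : IsClean G) (S : Split G N A B U) {u u' : V}
    (hu : u ∈ U) (hu' : u' ∈ U) (h : Leans G X A B u) (h' : Leans G X B A u') : False := by
  obtain ⟨a, ha⟩ := S.neA
  obtain ⟨b, hb⟩ := S.neB
  have huu : u ≠ u' := by
    rintro rfl
    obtain ⟨x, hx, hux⟩ := F.nbr u (S.subU hu)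
    exact (h' x hx hux).2 a ha ((h x hx hux).1 a ha)
  obtain ⟨P, hP⟩ := F.link (S.subU hu) (S.subU hu')
  have h1 := F.leans_link hG S hu hu' huu ha h h' hP
  have h2 := F.leans_link hG S.symm hu' hu huu.symm hb h' h hP.symm
  have hl : Link G X a b P := ⟨hP.ne, hP.ind, hP.mem, h1, fun z hz => by
    rw [h2 z (List.mem_reverse.2 hz), List.head?_reverse]⟩
  cases P with
  | nil => exact hP.ne rfl
  | cons m R =>
    obtain ⟨p, q, he, -, hq⟩ := F.split_touch hG S hu ha hb hl (z := m) (by simp) hP.head.1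
    exact hP.head.2 q (by simp [(List.cons.inj he).2]) hq

/-- Let `p, q` be the link seen by `w` and `x` a neighbour of `u` in `X`. Then `u, b, q, p, x` is a
hole, and `w` sees all of it except `x`: a jewel. -/
theorem not_leans_straddles (F : Frame G y N X) (hG : IsClean G) (S : Split G N A B U) {u w : V}
    (hu : u ∈ U) (hw : w ∈ U) (h : Leans G X A B u) (h' : Straddles G X A B w) : False := by
  obtain ⟨a, ha⟩ := S.neA
  obtain ⟨b, hb⟩ := S.neB
  obtain ⟨p, q, hl, hwp, hwq⟩ := h' a ha b hb
  obtain ⟨x, hx, hux⟩ := F.nbr u (S.subU hu)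
  have hpX := hl.mem p (by simp)
  have hqX := hl.mem q (by simp)
  have hpq := hl.ind.1 q (by simp)
  have hpq' : G.Adj p q := hpq.2.2 rfl
  have hap := hl.head.1
  have haq := hl.head.2 q (by simp)
  have hbq := hl.symm.head.1
  have hbp := hl.symm.head.2 p (by simp)
  have huq : ¬ G.Adj u q := fun hc => (h q hqX hc).2 b hb hbq
  have hup : ¬ G.Adj u p := by
    intro hc
    obtain ⟨p', q', he, -, hq⟩ := F.split_touch hG S hu ha hb hl (z := p) (by simp) hc
    simp at he
    exact huq (he.2 ▸ hq)
  obtain ⟨hA, hB⟩ := h x hx hux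
  have hxq : x ≠ q := by rintro rfl; exact huq hux
  have hxp : x ≠ p := by rintro rfl; exact hup hux
  have nxq : ¬ G.Adj x q := by
    intro hc
    have hl' := Link.two hx hqX hc (hA a ha) haq hbq (hB b hb)
    obtain ⟨p', q', he, -, hq⟩ := F.split_touch hG S hu ha hb hl' (z := x) (by simp) hux
    simp at he
    exact huq (he.2 ▸ hq)
  have nwx : ¬ G.Adj w x := fun hc => nxq (F.clique hG (S.subU hw) hx hqX hc hwq hxq)
  have hpx : G.Adj p x := F.clique hG (S.subA ha) hpX hx hap (hA a ha) hxp.symm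
  have huw : u ≠ w := by rintro rfl; exact nwx hux
  refine jewel_false hG.2.1 (b := u) (y := b) (a := q) (p := p) (R := [x]) (c := w)
    (by simp [IndPath, hpx, hxp.symm]) ?_ ?_ ?_ hbq (S.adjB u hu b hb).symm
    (F.ne (S.subU hu) hqX).symm (fun h => huq h.symm) (S.cliqueU hw hu huw.symm)
    (S.adjB w hw b hb) hwq hwp (by simpa using nwx)
  · simp [hpq'.symm, hpq'.ne', hxq.symm, hxp, G.adj_comm q x, nxq]
  · simp [hup, hux, hux.ne, F.ne (S.subU hu) hpX, hxp]
  · simp [hbp, hB b hb, F.ne (S.subB hb) hpX, F.ne (S.subB hb) hx]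

/-- Every neighbour of `w` in `X` lies on a two-vertex link between `a` and `b`, and by `touch_all`
`w'` sees all of every such link. -/
theorem straddles_adj (F : Frame G y N X) (hG : IsClean G) (S : Split G N A B U) {w w' x : V}
    (hw : w ∈ U) (hw' : w' ∈ U) (h : Straddles G X A B w) (h' : Straddles G X A B w')
    (hx : x ∈ X) (hwx : G.Adj w x) : G.Adj w' x := by
  obtain ⟨a, ha⟩ := S.neA
  obtain ⟨b, hb⟩ := S.neB
  have key : ∀ p q, Link G X a b [p, q] → G.Adj w' p ∧ G.Adj w' q := by
    intro p q hl
    obtain ⟨p', q', hl', hp', -⟩ := h' a ha b hb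
    obtain ⟨p1, q1, he, hp, hq⟩ := F.touch_all hG (S.subA ha) (S.subB hb) (S.subU hw')
      (S.anti a ha b hb).1 (S.anti a ha b hb).2 (S.adjA w' hw' a ha) (S.adjB w' hw' b hb) hl'
      ⟨p', by simp, hp'⟩ hl
    simp at he
    exact ⟨he.1 ▸ hp, he.2 ▸ hq⟩
  obtain ⟨p, q, hl, hp, hq⟩ := h a ha b hb
  rcases F.split_adj_or_adj hG S hw ha hb hx hwx with hc | hc
  · exact (key x q (F.link_two hG S hw ha hb hx (hl.mem q (by simp)) hwx hq hc
      hl.symm.head.1)).1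
  · exact (key p x (F.link_two hG S hw ha hb (hl.mem p (by simp)) hx hp hwx hl.head.1 hc)).2

end Frame

/-! ### End frames and candidate cliques -/

/-- The vertices in the closed neighbourhood of `y` that lie in (if `k` holds) or outside (if not) the
closed neighbourhood of `z`. -/
def cand (G : SimpleGraph V) (y z : V) (k : Prop) : Set V :=
  {v | (v = y ∨ G.Adj y v) ∧ ((v = z ∨ G.Adj z v) ↔ k)}

/-- A frame in which all edges leaving `X` end in `N`, and `Y` is a clique, complete to `N`, such that
every edge leaving `N` ends in `X ∪ Y`, and every edge leaving `Y` ends in `N`. -/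
structure EndFrame (G : SimpleGraph V) (y : V) (N X Y : Set V) : Prop extends Frame G y N X where
  mem : y ∈ Y
  cliqueY : G.IsClique Y
  adjY : ∀ n ∈ N, ∀ v ∈ Y, G.Adj n v
  antiY : ∀ v ∈ Y, ∀ x ∈ X, ¬ G.Adj v x
  nbrX : ∀ v ∈ X, ∀ w, G.Adj v w → w ∈ X ∨ w ∈ N
  nbrY : ∀ v ∈ Y, ∀ w, G.Adj v w → w ∈ N ∨ w ∈ Y
  nbrN : ∀ v ∈ N, ∀ w, G.Adj v w → w ∈ N ∨ w ∈ X ∨ w ∈ Y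

namespace EndFrame
variable {y : V} {N X Y A B U : Set V}

theorem isSimplicialClique (E : EndFrame G y N X Y) (hG : IsClean G) {K : Set V} (hYK : Y ⊆ K)
    (hK : K ⊆ Y ∪ N) (h1 : G.IsClique (N ∩ K)) (h2 : G.IsClique (N \ K))
    (h3 : ∀ s ∈ N ∩ K, ∀ t ∈ N \ K, G.Adj s t → ∀ x ∈ X, G.Adj s x → G.Adj t x) :
    IsSimplicialClique G K := by
  refine ⟨⟨y, hYK E.mem⟩, ?_, ?_⟩
  · intro u hu v hv huv
    rcases hK hu with hu' | hu' <;> rcases hK hv with hv' | hv'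
    · exact E.cliqueY hu' hv' huv
    · exact (E.adjY v hv' u hu').symm
    · exact E.adjY u hu' v hv'
    · exact h1 ⟨hu', hu⟩ ⟨hv', hv⟩ huv
  · rintro v hv u ⟨hvu, hu⟩ w ⟨hvw, hw⟩ huw
    rcases hK hv with hv' | hv'
    · have key : ∀ u, G.Adj v u → u ∉ K → u ∈ N \ K := fun u hu huK =>
        ⟨(E.nbrY v hv' u hu).resolve_right fun h => huK (hYK h), huK⟩
      exact h2 (key u hvu hu) (key w hvw hw) huw
    · have key : ∀ u, G.Adj v u → u ∉ K → u ∈ N ∨ u ∈ X := fun u hu huK => by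
        rcases E.nbrN v hv' u hu with h | h | h
        exacts [Or.inl h, Or.inr h, absurd (hYK h) huK]
      rcases key u hvu hu with hu' | hu' <;> rcases key w hvw hw with hw' | hw'
      · exact h2 ⟨hu', hu⟩ ⟨hw', hw⟩ huw
      · exact h3 v ⟨hv', hv⟩ u ⟨hu', hu⟩ hvu w hw' hvw
      · exact (h3 v ⟨hv', hv⟩ w ⟨hw', hw⟩ hvw u hu' hvu).symm
      · exact E.clique hG hv' hu' hw' hvu hvw huw

/-- Some candidate that contains `y` is a simplicial clique. -/
def Good (G : SimpleGraph V) (y : V) : Prop :=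
  ∃ z k, y ∈ cand G y z k ∧ IsSimplicialClique G (cand G y z k)

theorem cand_subset (E : EndFrame G y N X Y) (z : V) (k : Prop) : cand G y z k ⊆ Y ∪ N := by
  rintro v ⟨rfl | hv, -⟩
  · exact Or.inl E.mem
  · exact (E.nbrY y E.mem v hv).symm

theorem adj_y (E : EndFrame G y N X Y) {v : V} (hv : v ∈ Y) : v = y ∨ G.Adj y v := by
  by_cases h : v = y
  · exact Or.inl h
  · exact Or.inr (E.cliqueY E.mem hv (Ne.symm h))

theorem good_of_isClique (E : EndFrame G y N X Y) (hG : IsClean G) (hN : G.IsClique N) :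
    Good G y := by
  have hNK : N ⊆ cand G y y True := fun n hn => ⟨Or.inr (E.adj n hn), by simp [E.adj n hn]⟩
  refine ⟨y, True, by simp [cand], E.isSimplicialClique hG (fun v hv => ?_) (E.cand_subset y _)
    (hN.subset Set.inter_subset_left) (hN.subset Set.sdiff_subset) ?_⟩
  · exact ⟨E.adj_y hv, by simpa using E.adj_y hv⟩
  · rintro s - t ⟨ht, ht'⟩
    exact absurd (hNK ht) ht'

/-- For any `b ∈ B`, the closed neighbourhoods of `y` and `b` meet in `Y ∪ B ∪ U`. -/
theorem good_of_leans (E : EndFrame G y N X Y) (hG : IsClean G) (S : Split G N A B U)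
    (h : ∀ u ∈ U, Leans G X A B u) : Good G y := by
  obtain ⟨b, hb⟩ := S.neB
  have hbN := S.subB hb
  have hK : ∀ n ∈ N, n ∈ cand G y b True ↔ n ∉ A := by
    intro n hn
    simp only [cand, Set.mem_ofPred_eq, E.adj n hn, or_true, true_and, iff_true]
    constructor
    · rintro (rfl | h) hA
      · exact (S.anti n hA n hb).1 rfl
      · exact (S.anti n hA b hb).2 h.symm
    · intro hA
      rcases S.cover n hn with h | h | h
      · exact absurd h hA
      · by_cases hnb : n = b
        · exact Or.inl hnb
        · exact Or.inr (S.cliqueB hb h (Ne.symm hnb))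
      · exact Or.inr (S.adjB n h b hb).symm
  refine ⟨b, True, by simp [cand, (E.adj b hbN).symm], E.isSimplicialClique hG (fun v hv => ?_)
    (E.cand_subset b _) ?_ ?_ ?_⟩
  · exact ⟨E.adj_y hv, by simp [E.adjY b hbN v hv]⟩
  · rintro u ⟨hu, huK⟩ v ⟨hv, hvK⟩ huv
    rcases (S.cover u hu).resolve_left ((hK u hu).1 huK) with h1 | h1 <;>
      rcases (S.cover v hv).resolve_left ((hK v hv).1 hvK) with h2 | h2
    · exact S.cliqueB h1 h2 huv
    · exact (S.adjB v h2 u h1).symm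
    · exact S.adjB u h1 v h2
    · exact S.cliqueU h1 h2 huv
  · refine S.cliqueA.subset ?_
    rintro n ⟨hn, hnK⟩
    by_contra hA
    exact hnK ((hK n hn).2 hA)
  · rintro s ⟨hs, hsK⟩ t ⟨ht, htK⟩ hst x hx hsx
    have htA : t ∈ A := by
      by_contra hA
      exact htK ((hK t ht).2 hA)
    rcases (S.cover s hs).resolve_left ((hK s hs).1 hsK) with h1 | h1
    · exact absurd hst.symm (S.anti t htA s h1).2
    · exact (h s h1 x hx hsx).1 t htA

/-- The first vertex `p` of a link seen by `U` is complete to `A ∪ U` and anticomplete to `B ∪ Y`,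
so removing its closed neighbourhood from that of `y` leaves `Y ∪ B`. -/
theorem good_of_straddles (E : EndFrame G y N X Y) (hG : IsClean G) (S : Split G N A B U)
    (hU : U.Nonempty) (h : ∀ u ∈ U, Straddles G X A B u)
    (hB : ∀ b ∈ B, ∀ u ∈ U, ∀ x ∈ X, G.Adj b x → G.Adj u x) : Good G y := by
  obtain ⟨w, hw⟩ := hU
  obtain ⟨a₀, ha₀⟩ := S.neA
  obtain ⟨b₀, hb₀⟩ := S.neB
  obtain ⟨p, q, hl, hwp, hwq⟩ := h w hw a₀ ha₀ b₀ hb₀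
  have hpX := hl.mem p (by simp)
  have hBp : ∀ b ∈ B, ¬ G.Adj b p := fun b hb =>
    E.not_both hG S hw ha₀ hb hpX hwp hl.head.1
  have hAp : ∀ a ∈ A, G.Adj a p := fun a ha =>
    (E.split_adj_or_adj hG S hw ha hb₀ hpX hwp).resolve_right (hBp b₀ hb₀)
  have hUp : ∀ u ∈ U, G.Adj u p := fun u hu =>
    E.straddles_adj hG S hw hu (h w hw) (h u hu) hpX hwp
  have hK : ∀ n ∈ N, n ∈ cand G y p False ↔ n ∈ B := by
    intro n hn
    simp only [cand, Set.mem_ofPred_eq, E.adj n hn, or_true, true_and, iff_false, E.ne hn hpX,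
      false_or]
    constructor
    · intro hnp
      rcases S.cover n hn with h | h | h
      · exact absurd (hAp n h).symm hnp
      · exact h
      · exact absurd (hUp n h).symm hnp
    · exact fun hb h => hBp n hb h.symm
  have hYp : ∀ v ∈ Y, ¬ (v = p ∨ G.Adj p v) := by
    rintro v hv (rfl | h)
    · exact E.antiY y E.mem v hpX ((E.adj_y hv).resolve_left (E.anti v hpX).1.symm)
    · exact E.antiY v hv p hpX h.symm
  refine ⟨p, False, ⟨Or.inl rfl, by simpa using hYp y E.mem⟩, E.isSimplicialClique hG
    (fun v hv => ⟨E.adj_y hv, by simpa using hYp v hv⟩) (E.cand_subset p _) ?_ ?_ ?_⟩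
  · exact S.cliqueB.subset fun n hn => (hK n hn.1).1 hn.2
  · have key : ∀ n ∈ N \ cand G y p False, n ∈ A ∨ n ∈ U := fun n hn => by
      rcases S.cover n hn.1 with h | h | h
      exacts [Or.inl h, absurd ((hK n hn.1).2 h) hn.2, Or.inr h]
    intro u hu v hv huv
    rcases key u hu with h1 | h1 <;> rcases key v hv with h2 | h2
    · exact S.cliqueA h1 h2 huv
    · exact (S.adjA v h2 u h1).symm
    · exact S.adjA u h1 v h2
    · exact S.cliqueU h1 h2 huv
  · rintro s ⟨hs, hsK⟩ t ⟨ht, htK⟩ hst x hx hsx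
    have hsB := (hK s hs).1 hsK
    rcases S.cover t ht with h1 | h1 | h1
    · exact absurd hst.symm (S.anti t h1 s hsB).2
    · exact absurd ((hK t ht).2 h1) htK
    · exact hB s hsB t h1 x hx hsx

/-- A five-wheel with centre `c` through `y`, with vertices `x` and `x'` of `X` that are attached to
the two sides of it. -/
structure Obstacle (G : SimpleGraph V) (N X : Set V) (c a b x x' : V) : Prop where
  memc : c ∈ N
  mema : a ∈ N
  memb : b ∈ N
  ne : a ≠ b
  nadj : ¬ G.Adj a b
  adja : G.Adj c a
  adjb : G.Adj c b
  memx : x ∈ X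
  memx' : x' ∈ X
  adjx : G.Adj a x
  adjx' : G.Adj b x'
  nadjx : ¬ G.Adj c x
  nadjx' : ¬ G.Adj c x'
  touch : ∃ Q, Link G X a b Q ∧ ∃ z ∈ Q, G.Adj c z
  full : ∀ n ∈ N, n = c ∨ G.Adj c n

theorem Obstacle.symm {c a b x x' : V} (h : Obstacle G N X c a b x x') :
    Obstacle G N X c b a x' x where
  memc := h.memc
  mema := h.memb
  memb := h.mema
  ne := h.ne.symm
  nadj h' := h.nadj h'.symm
  adja := h.adjb
  adjb := h.adja
  memx := h.memx'
  memx' := h.memx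
  adjx := h.adjx'
  adjx' := h.adjx
  nadjx := h.nadjx'
  nadjx' := h.nadjx
  touch := by
    obtain ⟨Q, hQ, z, hz, hcz⟩ := h.touch
    exact ⟨_, hQ.symm, z, List.mem_reverse.2 hz, hcz⟩
  full := h.full

theorem good_or_obstacle (E : EndFrame G y N X Y) (hG : IsClean G) :
    Good G y ∨ ∃ c a b x x', Obstacle G N X c a b x x' := by
  by_cases hN : G.IsClique N
  · exact Or.inl (E.good_of_isClique hG hN)
  simp only [SimpleGraph.IsClique, Set.Pairwise, not_forall] at hN
  obtain ⟨a, ha, b, hb, hab, nab⟩ := hN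
  obtain ⟨A, B, U, S⟩ := E.exists_split hG ha hb hab nab
  by_cases hA : ∀ u ∈ U, Leans G X A B u
  · exact Or.inl (E.good_of_leans hG S hA)
  by_cases hB : ∀ u ∈ U, Leans G X B A u
  · exact Or.inl (E.good_of_leans hG S.symm hB)
  have hS : ∀ u ∈ U, Straddles G X A B u := by
    push Not at hA hB
    obtain ⟨u, hu, nu⟩ := hA
    obtain ⟨v, hv, nv⟩ := hB
    obtain ⟨w, hw, hws⟩ : ∃ w ∈ U, Straddles G X A B w := by
      rcases E.trichotomy hG S hu with h | h | h
      · exact absurd h nu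
      · rcases E.trichotomy hG S hv with h' | h' | h'
        · exact (E.not_leans_leans hG S hv hu h' h).elim
        · exact absurd h' nv
        · exact ⟨v, hv, h'⟩
      · exact ⟨u, hu, h⟩
    intro t ht
    rcases E.trichotomy hG S ht with h | h | h
    · exact (E.not_leans_straddles hG S ht hw h hws).elim
    · exact (E.not_leans_straddles hG S.symm ht hw h hws.symm).elim
    · exact h
  have hU : U.Nonempty := by
    push Not at hA
    obtain ⟨u, hu, -⟩ := hA
    exact ⟨u, hu⟩
  by_cases h1 : ∀ b ∈ B, ∀ u ∈ U, ∀ x ∈ X, G.Adj b x → G.Adj u x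
  · exact Or.inl (E.good_of_straddles hG S hU hS h1)
  by_cases h2 : ∀ a ∈ A, ∀ u ∈ U, ∀ x ∈ X, G.Adj a x → G.Adj u x
  · exact Or.inl (E.good_of_straddles hG S.symm hU (fun u hu => (hS u hu).symm) h2)
  push Not at h1 h2
  obtain ⟨b, hb, u', hu', x', hx', hbx', nux'⟩ := h1
  obtain ⟨a, ha, u, hu, x, hx, hax, nux⟩ := h2
  refine Or.inr ⟨u, a, b, x, x', S.subU hu, S.subA ha, S.subB hb, (S.anti a ha b hb).1,
    (S.anti a ha b hb).2, S.adjA u hu a ha, S.adjB u hu b hb, hx, hx', hax, hbx', nux, ?_, ?_, ?_⟩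
  · exact fun h => nux' (E.straddles_adj hG S hu hu' (hS u hu) (hS u' hu') hx' h)
  · obtain ⟨p, q, hl, hp, -⟩ := hS u hu a ha b hb
    exact ⟨_, hl, p, by simp, hp⟩
  · intro n hn
    rcases S.cover n hn with h | h | h
    · exact Or.inr (S.adjA u hu n h)
    · exact Or.inr (S.adjB u hu n h)
    · by_cases hnu : n = u
      · exact Or.inl hnu
      · exact Or.inr (S.cliqueU hu h (Ne.symm hnu))

end EndFrame
-- Choosing the end frame extremally
open Relation EndFrame

/-- The vertices reachable from `x` inside `S`. -/
def reach (G : SimpleGraph V) (S : Set V) (x : V) : Set V := {v | ReflTransGen (StepIn G S) x v}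

/-- The vertices outside the closed neighbourhood of `w`. -/
def outside (G : SimpleGraph V) (w : V) : Set V := {v | v ≠ w ∧ ¬ G.Adj w v}

theorem stepIn_mono {S T : Set V} (h : S ⊆ T) {s t : V} (hst : ReflTransGen (StepIn G S) s t) :
    ReflTransGen (StepIn G T) s t :=
  ReflTransGen.mono (r := StepIn G S) (p := StepIn G T) (fun _ _ h' => ⟨h'.1, h h'.2⟩) _ _ hst

theorem mem_of_stepIn {S : Set V} {s t : V} (hs : s ∈ S) (h : ReflTransGen (StepIn G S) s t) :
    t ∈ S := by
  induction h with
  | refl => exact hs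
  | tail _ h _ => exact h.2

theorem stepIn_symm {S : Set V} {s t : V} (hs : s ∈ S) (h : ReflTransGen (StepIn G S) s t) :
    ReflTransGen (StepIn G S) t s := by
  induction h with
  | refl => exact .refl
  | tail h1 h2 ih => exact .head ⟨h2.1.symm, mem_of_stepIn hs h1⟩ ih

theorem connected_insert {X : Set V} {n : V}
    (hX : ∀ s ∈ X, ∀ t ∈ X, ReflTransGen (StepIn G X) s t) (hn : ∃ x ∈ X, G.Adj n x) :
    ∀ s ∈ insert n X, ∀ t ∈ insert n X, ReflTransGen (StepIn G (insert n X)) s t := by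
  obtain ⟨x, hx, hnx⟩ := hn
  have key : ∀ s ∈ insert n X, ReflTransGen (StepIn G (insert n X)) s x := by
    rintro s (rfl | hs)
    · exact .single ⟨hnx, Or.inr hx⟩
    · exact stepIn_mono (Set.subset_insert _ _) (hX s hs x hx)
  exact fun s hs t ht => (key s hs).trans (stepIn_symm ht (key t ht))

/-- The end frame obtained from a maximal connected set `X ∋ r` that does not dominate the component
`D` of `outside G r`. -/
theorem exists_endFrame [Finite V] (hG : IsClean G) (hc : G.Connected) {r d : V}
    (hd : d ∈ outside G r) :
    ∃ y N X Y, EndFrame G y N X Y ∧ r ∈ X ∧ y ∈ reach G (outside G r) d := by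
  let D := reach G (outside G r) d
  have hD : D ⊆ outside G r := fun v hv => mem_of_stepIn hd hv
  have hDadj : ∀ v ∈ D, ∀ w ∈ outside G r, G.Adj v w → w ∈ D := fun v hv w hw h =>
    ReflTransGen.tail hv ⟨h, hw⟩
  let T : Set (Set V) := {X | r ∈ X ∧ (∀ s ∈ X, ∀ t ∈ X, ReflTransGen (StepIn G X) s t) ∧
    ∃ v ∈ D, v ∉ X ∧ ∀ x ∈ X, ¬ G.Adj v x}
  have hT : T.Nonempty := by
    refine ⟨{r}, rfl, ?_, d, .refl, hd.1, ?_⟩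
    · rintro s rfl t rfl
      exact .refl
    · rintro x rfl h
      exact hd.2 h.symm
  obtain ⟨X, ⟨hrX, hXc, y, hyD, hyX, hyn⟩, hmax⟩ := T.toFinite.exists_maximalFor Set.ncard T hT
  let Y : Set V := {v | v ∈ D ∧ v ∉ X ∧ ∀ x ∈ X, ¬ G.Adj v x}
  let N : Set V := {v | v ∉ X ∧ ∃ x ∈ X, G.Adj v x}
  have hNY : ∀ n ∈ N, ∀ v ∈ Y, G.Adj n v := by
    rintro n ⟨hnX, hn⟩ v ⟨hvD, hvX, hv⟩
    by_contra hnv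
    -- If `n` misses `v`, then `v` witnesses that `X` with `n` added still does not dominate `D`,
    -- against maximality.
    have hins : insert n X ∈ T := by
      refine ⟨Or.inr hrX, connected_insert hXc hn, v, hvD, ?_, ?_⟩
      · rintro (rfl | h)
        · obtain ⟨x, hx, h⟩ := hn
          exact hv x hx h
        · exact hvX h
      · rintro x (rfl | hx) h
        · exact hnv h.symm
        · exact hv x hx h
    have h1 := Set.ncard_insert_of_notMem hnX X.toFinite
    have h2 := hmax hins (by simp only [h1]; omega)
    simp only [h1] at h2
    omega
  have hcl : ∀ v, v ∉ X → v ∈ outside G r → v ∉ N → v ∈ D → v ∈ Y := fun v h1 _ h2 h3 =>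
    ⟨h3, h1, fun x hx h => h2 ⟨h1, x, hx, h⟩⟩
  have hout : ∀ v, v ∉ X → v ∉ N → v ∈ outside G r := fun v h1 h2 =>
    ⟨by rintro rfl; exact h1 hrX, fun h => h2 ⟨h1, r, hrX, h.symm⟩⟩
  have hyY : y ∈ Y := ⟨hyD, hyX, hyn⟩
  obtain ⟨n₀, hn₀⟩ : N.Nonempty := by
    by_contra hN
    rw [Set.not_nonempty_iff_eq_empty] at hN
    have h1 := (SimpleGraph.reachable_iff_reflTransGen _ _).1 (hc.preconnected r y)
    have : y ∈ X := by
      clear hyY hyn hyX hyD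
      induction h1 with
      | refl => exact hrX
      | @tail v w _ h ih =>
        by_contra hw
        have : w ∈ N := ⟨hw, v, ih, h.symm⟩
        rw [hN] at this
        exact this
    exact hyX this
  refine ⟨y, N, X, Y, ?_, hrX, hyD⟩
  refine { adj := fun n hn => (hNY n hn y hyY).symm, anti := ?_, conn := hXc, nbr := fun n hn => hn.2,
           mem := hyY, cliqueY := ?_, adjY := hNY, antiY := fun v hv => hv.2.2, nbrX := ?_, nbrY := ?_, nbrN := ?_ }
  · exact fun x hx => ⟨by rintro rfl; exact hyX hx, hyn x hx⟩
  · intro u hu v hv huv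
    -- Two nonadjacent vertices of `Y` and a neighbour of `n₀` in `X` would form a claw at `n₀`.
    obtain ⟨x, hx, hnx⟩ := hn₀.2
    rcases claw hG (hNY _ hn₀ u hu) (hNY _ hn₀ v hv) hnx huv (by rintro rfl; exact hu.2.1 hx)
      (by rintro rfl; exact hv.2.1 hx) with h | h | h
    exacts [h, absurd h (hu.2.2 x hx), absurd h (hv.2.2 x hx)]
  · intro v hv w hvw
    by_cases hw : w ∈ X
    · exact Or.inl hw
    · exact Or.inr ⟨hw, v, hv, hvw.symm⟩
  · intro v hv w hvw
    by_cases hw : w ∈ N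
    · exact Or.inl hw
    have hwX : w ∉ X := fun h => hv.2.2 w h hvw
    have hwo := hout w hwX hw
    exact Or.inr (hcl w hwX hwo hw (hDadj v hv.1 w hwo hvw))
  · intro n hn w hnw
    by_cases hw : w ∈ N
    · exact Or.inl hw
    by_cases hwX : w ∈ X
    · exact Or.inr (Or.inl hwX)
    have hwo := hout w hwX hw
    refine Or.inr (Or.inr (hcl w hwX hwo hw ?_))
    obtain ⟨x, hx, hnx⟩ := hn.2
    by_cases hyw : y = w
    · exact hyw ▸ hyD
    rcases claw hG hnx (hNY n hn y hyY) hnw (by rintro rfl; exact hyX hx)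
      (by rintro rfl; exact hwX hx) hyw with h | h | h
    · exact absurd h.symm (hyn x hx)
    · exact absurd ⟨hwX, x, hx, h.symm⟩ hw
    · exact hDadj y hyD w hwo h

namespace EndFrame
variable {y : V} {N X Y : Set V} {c a b x x' r d : V}

/-- A walk avoiding the closed neighbourhood of `c` cannot enter `N`, so it stays in `X`. It would
give a link between `a` and `b` that `c` does not see, although `c` sees another one, contrary to
`touch_all`. -/
theorem obstacle_not_reach (E : EndFrame G y N X Y) (hG : IsClean G)
    (hO : Obstacle G N X c a b x x') : x' ∉ reach G (outside G c) x := by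
  intro h
  have key : ∀ t, ReflTransGen (StepIn G (outside G c)) x t →
      ReflTransGen (StepIn G (X ∩ outside G c)) x t ∧ t ∈ X := by
    intro t ht
    induction ht with
    | refl => exact ⟨.refl, hO.memx⟩
    | @tail v w _ h ih =>
      have hw : w ∈ X := (E.nbrX v ih.2 w h.1).resolve_right fun hwN => by
        rcases hO.full w hwN with h' | h'
        exacts [h.2.1 h', h.2.2 h']
      exact ⟨ih.1.tail ⟨h.1, hw, h.2⟩, hw⟩
  obtain ⟨P, hP⟩ := exists_link (S := X ∩ outside G c)
    ⟨hO.memx, (E.ne hO.memc hO.memx).symm, hO.nadjx⟩ hO.adjx hO.adjx' (key x' h).1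
  obtain ⟨Q, hQ, hcQ⟩ := hO.touch
  obtain ⟨p, q, rfl, hp, -⟩ := E.touch_all hG hO.mema hO.memb hO.memc hO.ne hO.nadj hO.adja hO.adjb
    hQ hcQ (hP.mono fun z hz => (hP.mem z hz).1)
  exact (hP.mem p (by simp)).2.2 hp

/-- From `y` one reaches `a`, then `x`, then the whole component of `x`, never meeting the closed
neighbourhood of `r`. The inclusion is proper because `y` is adjacent to `c`. -/
theorem obstacle_lt [Finite V] (E : EndFrame G y N X Y) (hO : Obstacle G N X c a b x x')
    (hr : r ∈ X) (hy : y ∈ reach G (outside G r) d) (hr1 : r ∉ reach G (outside G c) x)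
    (hr2 : ∀ t ∈ reach G (outside G c) x, ¬ G.Adj r t) (hra : ¬ G.Adj r a) :
    (reach G (outside G c) x).ncard < (reach G (outside G r) d).ncard := by
  have hxo : x ∈ outside G c := ⟨(E.ne hO.memc hO.memx).symm, hO.nadjx⟩
  have hstep : ∀ {v w}, v ∈ reach G (outside G r) d → G.Adj v w → w ≠ r → ¬ G.Adj r w →
      w ∈ reach G (outside G r) d := fun hv h h1 h2 => ReflTransGen.tail hv ⟨h, h1, h2⟩
  have ha := hstep hy (E.adj a hO.mema) (E.ne hO.mema hr) hra
  refine Set.ncard_lt_ncard ⟨fun t ht => ?_, fun h => ?_⟩ (Set.toFinite _)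
  · have ht : ReflTransGen (StepIn G (outside G c)) x t := ht
    induction ht with
    | refl => exact hstep ha hO.adjx (by rintro rfl; exact hr1 .refl) (hr2 x .refl)
    | @tail v w h1 h2 ih =>
      have hw : w ∈ reach G (outside G c) x := ReflTransGen.tail h1 h2
      exact hstep (ih h1) h2.1 (by rintro rfl; exact hr1 hw) (hr2 w hw)
  · exact (mem_of_stepIn hxo (h hy)).2 (E.adj c hO.memc).symm

/-- One of the components of `x` and `x'` neither contains `r` nor has a neighbour of `r`, and
`obstacle_lt` applies to it. -/
theorem obstacle_reach_lt [Finite V] (E : EndFrame G y N X Y) (hG : IsClean G)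
    (hO : Obstacle G N X c a b x x') (hr : r ∈ X) (hy : y ∈ reach G (outside G r) d) :
    (reach G (outside G c) x).ncard < (reach G (outside G r) d).ncard ∨
      (reach G (outside G c) x').ncard < (reach G (outside G r) d).ncard := by
  -- If `r` sees `c` and `a`, it sees `x` as well; a neighbour of `r` in the component of `x'` would
  -- then form a claw at `r` with `x` and `c`.
  have near : ∀ {a b x x'}, Obstacle G N X c a b x x' → G.Adj c r → G.Adj a r →
      (reach G (outside G c) x').ncard < (reach G (outside G r) d).ncard := by
    intro a b x x' hO hcr har
    have hxo : x ∈ outside G c := ⟨(E.ne hO.memc hO.memx).symm, hO.nadjx⟩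
    have hxo' : x' ∈ outside G c := ⟨(E.ne hO.memc hO.memx').symm, hO.nadjx'⟩
    refine E.obstacle_lt hO.symm hr hy (fun h => (mem_of_stepIn hxo' h).2 hcr) ?_ ?_
    · intro t ht hrt
      have hto := mem_of_stepIn hxo' ht
      have hxr : x ≠ r := by rintro rfl; exact hO.nadjx hcr
      have hrx := (E.clique hG hO.mema hO.memx hr hO.adjx har hxr).symm
      have hx' := E.obstacle_not_reach hG hO.symm
      rcases claw hG hrx hcr.symm hrt hxo.1 (by rintro rfl; exact hx' ht) hto.1.symm with h | h | h
      · exact hxo.2 h.symm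
      · exact hx' (ReflTransGen.tail ht ⟨h.symm, hxo⟩)
      · exact hto.2 h
    · exact fun h => E.four_wheel hG hO.mema hO.memb hO.memc hr hO.ne hO.nadj hO.adja hO.adjb har
        h.symm hcr
  have far : ∀ {a b x x'}, Obstacle G N X c a b x x' → ¬ G.Adj c r →
      r ∉ reach G (outside G c) x →
      (reach G (outside G c) x).ncard < (reach G (outside G r) d).ncard := by
    intro a b x x' hO hcr hrx
    have hro : r ∈ outside G c := ⟨(E.ne hO.memc hr).symm, hcr⟩
    have h2 : ∀ t ∈ reach G (outside G c) x, ¬ G.Adj r t := fun t ht h =>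
      hrx (ReflTransGen.tail ht ⟨h.symm, hro⟩)
    refine E.obstacle_lt hO hr hy hrx h2 fun hra => ?_
    refine h2 x .refl (E.clique hG hO.mema hr hO.memx hra.symm hO.adjx ?_)
    rintro rfl
    exact hrx .refl
  by_cases hcr : G.Adj c r
  · rcases E.adj_or_adj hG hO.mema hO.memb hO.ne hO.nadj hO.adja hO.adjb hr hcr with h | h
    · exact Or.inr (near hO hcr h)
    · exact Or.inl (near hO.symm hcr h)
  · by_cases hrx : r ∈ reach G (outside G c) x
    · refine Or.inr (far hO.symm hcr fun hrx' => E.obstacle_not_reach hG hO ?_)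
      exact ReflTransGen.trans hrx
        (stepIn_symm ⟨(E.ne hO.memc hO.memx').symm, hO.nadjx'⟩ hrx')
    · exact Or.inl (far hO hcr hrx)

end EndFrame

theorem exists_good_of_connected [Finite V] (hG : IsClean G) (hc : G.Connected) :
    ∃ y, Good G y := by
  let T : Set (V × V) := {p | p.2 ∈ outside G p.1}
  rcases T.eq_empty_or_nonempty with hT | hT
  · have hadj : ∀ u v, v = u ∨ G.Adj u v := by
      intro u v
      by_contra h
      push Not at h
      have : (u, v) ∈ T := h
      rw [hT] at this
      exact this
    obtain ⟨y⟩ := hc.nonempty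
    have hK : cand G y y True = Set.univ := by
      ext v
      simpa [cand] using hadj y v
    refine ⟨y, y, True, by simp [hK], ?_⟩
    rw [hK]
    exact ⟨⟨y, trivial⟩, fun u _ v _ huv => (hadj u v).resolve_left huv.symm,
      fun v _ u hu => absurd trivial hu.2⟩
  · obtain ⟨⟨r, d⟩, hd, hmin⟩ := T.toFinite.exists_minimalFor
      (fun p => (reach G (outside G p.1) p.2).ncard) T hT
    obtain ⟨y, N, X, Y, E, hr, hy⟩ := exists_endFrame hG hc hd
    refine ⟨y, (E.good_or_obstacle hG).resolve_right ?_⟩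
    rintro ⟨c, a, b, x, x', hO⟩
    have hx : (c, x) ∈ T := ⟨(E.ne hO.memc hO.memx).symm, hO.nadjx⟩
    have hx' : (c, x') ∈ T := ⟨(E.ne hO.memc hO.memx').symm, hO.nadjx'⟩
    rcases E.obstacle_reach_lt hG hO hr hy with h | h
    · have := hmin hx h.le
      exact absurd h (not_lt.2 this)
    · have := hmin hx' h.le
      exact absurd h (not_lt.2 this)

/-! ### Reduction to a connected component -/

theorem isClean_induce (hG : IsClean G) (s : Set V) : IsClean (G.induce s) := by
  let e : G.induce s ↪g G := SimpleGraph.Embedding.induce s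
  obtain ⟨h1, h2, h3, h4, h5⟩ := hG
  refine ⟨fun ⟨f⟩ => h1 ⟨e.comp f⟩, ?_, ?_, ?_, fun ⟨f⟩ => h5 ⟨e.comp f⟩⟩
  · rintro ⟨k, h, v, hk, hv, ha⟩
    exact h2 ⟨k, e.comp h, v, hk, fun i hi => hv i (Subtype.ext hi), ha⟩
  · rintro ⟨k, h, v, j, hk, h6, h7, hv, ha⟩
    exact h3 ⟨k, e.comp h, v, j, hk, h6, h7, fun i hi => hv i (Subtype.ext hi), ha⟩
  · rintro ⟨m, h, p, hp, ha⟩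
    exact h4 ⟨m, e.comp h, e.comp p, fun i j hi => hp i j (Subtype.ext hi), ha⟩

theorem exists_good [Finite V] [Nonempty V] (hG : IsClean G) : ∃ y, Good G y := by
  obtain ⟨v₀⟩ := ‹Nonempty V›
  let C := G.connectedComponentMk v₀
  let s : Set V := C.supp
  have hs : ∀ v w, v ∈ s → G.Adj v w → w ∈ s := fun v w hv h =>
    (SimpleGraph.ConnectedComponent.mem_supp_congr_adj C h).1 hv
  obtain ⟨y, z, k, hyK, hne, hcl, hsim⟩ :=
    exists_good_of_connected (isClean_induce hG s) C.connected_toSimpleGraph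
  have hK : ∀ v, v ∈ cand G y z k ↔ ∃ h : v ∈ s, (⟨v, h⟩ : s) ∈ cand (G.induce s) y z k := by
    intro v
    constructor
    · rintro ⟨h1, h2⟩
      have hv : v ∈ s := by
        rcases h1 with rfl | h1
        exacts [y.2, hs y v y.2 h1]
      exact ⟨hv, by simpa [Subtype.ext_iff] using h1, by simpa [Subtype.ext_iff] using h2⟩
    · rintro ⟨h, h1, h2⟩
      exact ⟨by simpa [Subtype.ext_iff] using h1, by simpa [Subtype.ext_iff] using h2⟩
  refine ⟨y, z, k, (hK y).2 ⟨y.2, hyK⟩, ⟨y, (hK y).2 ⟨y.2, hyK⟩⟩, ?_, ?_⟩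
  · intro u hu v hv huv
    obtain ⟨hu, hu'⟩ := (hK u).1 hu
    obtain ⟨hv, hv'⟩ := (hK v).1 hv
    exact hcl hu' hv' (fun h => huv (congrArg Subtype.val h))
  · rintro v hv u ⟨hvu, hu⟩ w ⟨hvw, hw⟩ huw
    obtain ⟨hvs, hv'⟩ := (hK v).1 hv
    have hus := hs v u hvs hvu
    have hws := hs v w hvs hvw
    exact hsim ⟨v, hvs⟩ hv' (x := ⟨u, hus⟩) (y := ⟨w, hws⟩) ⟨hvu, fun h => hu ((hK u).2 ⟨hus, h⟩)⟩
      ⟨hvw, fun h => hw ((hK w).2 ⟨hws, h⟩)⟩ (fun h => huw (congrArg Subtype.val h))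

end CleanGraph

/-! ### Hoare triples with time bounds -/

namespace WordRAM

abbrev Regs := ℕ → ℕ

/-- Position-dependent code: the instructions when the first one stands in line `l`. -/
abbrev Code := ℕ → Program

/-- `P` contains the instructions `c` from line `l` on. -/
def CodeAt (P : Program) (l : ℕ) (c : Program) : Prop := ∃ A B, P = A ++ c ++ B ∧ A.length = l

theorem CodeAt.left {P : Program} {l : ℕ} {c d : Program} (h : CodeAt P l (c ++ d)) :
    CodeAt P l c := by
  obtain ⟨A, B, rfl, hA⟩ := h
  exact ⟨A, d ++ B, by simp, hA⟩

theorem CodeAt.right {P : Program} {l : ℕ} {c d : Program} (h : CodeAt P l (c ++ d)) :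
    CodeAt P (l + c.length) d := by
  obtain ⟨A, B, rfl, hA⟩ := h
  exact ⟨A ++ c, B, by simp, by simp [hA]⟩

theorem CodeAt.getElem? {P : Program} {l : ℕ} {i : Instr} {c : Program}
    (h : CodeAt P l (i :: c)) : P[l]? = some i := by
  obtain ⟨A, B, rfl, rfl⟩ := h
  simp

theorem Steps.trans {W : ℕ} {P : Program} {t t' : ℕ} {s s' s'' : Config} (h : Steps W P t s s')
    (h' : Steps W P t' s' s'') : Steps W P (t + t') s s'' := by
  induction h with
  | refl => simpa using h'
  | @head t _ _ _ h1 _ ih =>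
    rw [show t + 1 + t' = t + t' + 1 by omega]
    exact .head h1 (ih h')

/-- Started in a state with `Pre`, the code `c` terminates within `T` steps in a state with `Post`, with
control just behind it. -/
def Triple (W : ℕ) (Pre : Regs → Regs → Prop) (c : Code) (Post : Regs → Regs → Prop) (T : ℕ) :
    Prop :=
  ∀ P l r m, CodeAt P l (c l) → Pre r m → ∃ t ≤ T, ∃ r' m',
    Steps W P t ⟨l, r, m⟩ ⟨l + (c l).length, r', m'⟩ ∧ Post r' m'

theorem Triple.conseq {W : ℕ} {Pre Pre' Post Post' : Regs → Regs → Prop} {c : Code} {T T' : ℕ}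
    (h : Triple W Pre c Post T) (h1 : ∀ r m, Pre' r m → Pre r m)
    (h2 : ∀ r m, Post r m → Post' r m) (hT : T ≤ T') : Triple W Pre' c Post' T' := by
  intro P l r m hc hp
  obtain ⟨t, ht, r', m', hs, hq⟩ := h P l r m hc (h1 r m hp)
  exact ⟨t, ht.trans hT, r', m', hs, h2 _ _ hq⟩

/-- Sequential composition. -/
def seq (c d : Code) : Code := fun l => c l ++ d (l + (c l).length)

theorem Triple.seq {W : ℕ} {Pre Mid Post : Regs → Regs → Prop} {c d : Code} {T T' : ℕ}
    (h : Triple W Pre c Mid T) (h' : Triple W Mid d Post T') :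
    Triple W Pre (seq c d) Post (T + T') := by
  intro P l r m hc hp
  obtain ⟨t, ht, r', m', hs, hq⟩ := h P l r m hc.left hp
  obtain ⟨t', ht', r'', m'', hs', hq'⟩ := h' P _ r' m' hc.right hq
  refine ⟨t + t', by omega, r'', m'', ?_, hq'⟩
  have := hs.trans hs'
  simpa [WordRAM.seq, Nat.add_assoc] using this

/-- The weakest precondition of a block of instructions without jumps. -/
def wp (W : ℕ) (Q : Regs → Regs → Prop) : Program → Regs → Regs → Prop
  | [], r, m => Q r m
  | .const d v :: c, r, m => v < W ∧ wp W Q c (Function.update r d v) m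
  | .add d a b :: c, r, m => r a + r b < W ∧ wp W Q c (Function.update r d (r a + r b)) m
  | .sub d a b :: c, r, m => r a - r b < W ∧ wp W Q c (Function.update r d (r a - r b)) m
  | .mul d a b :: c, r, m => r a * r b < W ∧ wp W Q c (Function.update r d (r a * r b)) m
  | .load d a :: c, r, m => m (r a) < W ∧ wp W Q c (Function.update r d (m (r a))) m
  | .store a b :: c, r, m => wp W Q c r (Function.update m (r a) (r b))
  | _ :: _, _, _ => False

theorem triple_block {W : ℕ} {Q : Regs → Regs → Prop} (c : Program) :
    Triple W (wp W Q c) (fun _ => c) Q c.length := by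
  induction c with
  | nil => exact fun P l r m _ hp => ⟨0, le_rfl, r, m, .refl _, hp⟩
  | cons i c ih =>
    intro P l r m hc hp
    have hi := hc.getElem?
    have hc' : CodeAt P (l + 1) c := CodeAt.right (c := [i]) hc
    have key : ∀ r' m', step W P ⟨l, r, m⟩ = some ⟨l + 1, r', m'⟩ → wp W Q c r' m' →
        ∃ t ≤ (i :: c).length, ∃ r' m',
          Steps W P t ⟨l, r, m⟩ ⟨l + (i :: c).length, r', m'⟩ ∧ Q r' m' := by
      intro r' m' hs hq
      obtain ⟨t, ht, r'', m'', hs', hq'⟩ := ih P (l + 1) r' m' hc' hq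
      refine ⟨t + 1, by simpa using ht, r'', m'', .head hs ?_, hq'⟩
      rwa [show l + (i :: c).length = l + 1 + c.length by simp; omega]
    cases i <;> simp only [wp] at hp <;> first
      | exact key _ _ (by simp [step, hi, Instr.exec, Config.write, hp.1]) hp.2
      | exact key _ _ (by simp [step, hi, Instr.exec]) hp

/-- Execute `body` for the values `0, …, R[b] - 1` of register `d`, where `R[b] > 0` and `R[1] = 1`. -/
def loop (d b : ℕ) (body : Code) : Code := fun l =>
  .const d 0 :: (body (l + 1) ++ [.add d d 1, .jlt d b (l + 1)])

/-- The counter is tested after the body, hence `0 < N`. The invariant must not depend on the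
counter register (`hI`), which changes between rounds. Each round costs the body and two
instructions. -/
theorem triple_loop {W N T d b : ℕ} {body : Code} {I : ℕ → Regs → Regs → Prop} (hN : 0 < N)
    (hNW : N < W) (hI : ∀ i r m v, I i r m → I i (Function.update r d v) m)
    (hr : ∀ i r m, I i r m → r 1 = 1 ∧ r b = N)
    (hbody : ∀ i < N, Triple W (fun r m => I i r m ∧ r d = i) body
      (fun r m => I (i + 1) r m ∧ r d = i) T) :
    Triple W (I 0) (loop d b body) (I N) (1 + N * (T + 2)) := by
  intro P l r m hc hp
  have h0 := hc.getElem?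
  have hc1 : CodeAt P (l + 1) (body (l + 1) ++ [.add d d 1, .jlt d b (l + 1)]) :=
    CodeAt.right (c := [.const d 0]) hc
  have ha := hc1.right.getElem?
  have hj := (CodeAt.right (c := [.add d d 1]) hc1.right).getElem?
  have hlen : (loop d b body l).length = (body (l + 1)).length + 3 := by simp [loop]
  have key : ∀ k i, i + k + 1 = N → ∀ r m, I i r m → r d = i →
      ∃ t ≤ (k + 1) * (T + 2), ∃ r' m',
        Steps W P t ⟨l + 1, r, m⟩ ⟨l + (loop d b body l).length, r', m'⟩ ∧ I N r' m' := by
    intro k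
    induction k with
    | zero =>
      intro i hi r m hIi hd
      obtain ⟨t, ht, r1, m1, hs, hI1, hd1⟩ := hbody i (by omega) P (l + 1) r m hc1.left ⟨hIi, hd⟩
      have e1 := (hr _ _ _ hI1).1
      have hI2 := hI _ _ _ (i + 1) hI1
      have e2 := (hr _ _ _ hI2).2
      refine ⟨t + (0 + 1 + 1), by omega, Function.update r1 d (i + 1), m1, hs.trans
        (.head (s' := ⟨l + 1 + (body (l + 1)).length + 1, Function.update r1 d (i + 1), m1⟩) ?_
          (.head ?_ (.refl _))), ?_⟩
      · simp [step, ha, Instr.exec, Config.write, hd1, e1, (by omega : i + 1 < W)]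
      · have hj' : P[l + 1 + (body (l + 1)).length + 1]? = some (.jlt d b (l + 1)) := hj
        simp only [step, hj', Instr.exec, Config.branch, Option.bind_some, e2,
          Function.update_self, hlen]
        rw [if_neg (by omega)]
        congr 2
        omega
      · rwa [show N = i + 1 by omega]
    | succ k ih =>
      intro i hi r m hIi hd
      obtain ⟨t, ht, r1, m1, hs, hI1, hd1⟩ := hbody i (by omega) P (l + 1) r m hc1.left ⟨hIi, hd⟩
      have e1 := (hr _ _ _ hI1).1
      have hI2 := hI _ _ _ (i + 1) hI1
      have e2 := (hr _ _ _ hI2).2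
      obtain ⟨t', ht', r', m', hs', hI'⟩ := ih (i + 1) (by omega) _ m1 hI2 (by simp)
      refine ⟨t + (t' + 1 + 1), ?_, r', m', hs.trans
        (.head (s' := ⟨l + 1 + (body (l + 1)).length + 1, Function.update r1 d (i + 1), m1⟩) ?_
          (.head ?_ hs')), hI'⟩
      · rw [Nat.add_mul (k + 1) 1]; omega
      · simp [step, ha, Instr.exec, Config.write, hd1, e1, (by omega : i + 1 < W)]
      · have hj' : P[l + 1 + (body (l + 1)).length + 1]? = some (.jlt d b (l + 1)) := hj
        simp only [step, hj', Instr.exec, Config.branch, Option.bind_some, e2,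
          Function.update_self]
        rw [if_pos (by omega)]
  obtain ⟨t, ht, r', m', hs, hq⟩ := key (N - 1) 0 (by omega) _ m (hI _ _ _ 0 hp) (by simp)
  refine ⟨t + 1, ?_, r', m', .head ?_ hs, hq⟩
  · rw [Nat.sub_add_cancel hN] at ht; omega
  · simp [step, h0, Instr.exec, Config.write, (by omega : 0 < W)]

/-- The loop rule with polynomial time bounds. -/
theorem triple_loop_pow {W N C k d b : ℕ} {body : Code} {I : ℕ → Regs → Regs → Prop} (hN : 0 < N)
    (hNW : N < W) (hI : ∀ i r m v, I i r m → I i (Function.update r d v) m)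
    (hr : ∀ i r m, I i r m → r 1 = 1 ∧ r b = N)
    (hbody : ∀ i < N, Triple W (fun r m => I i r m ∧ r d = i) body
      (fun r m => I (i + 1) r m ∧ r d = i) (C * N ^ k)) :
    Triple W (I 0) (loop d b body) (I N) ((C + 3) * N ^ (k + 1)) := by
  refine (triple_loop hN hNW hI hr hbody).conseq (fun _ _ h => h) (fun _ _ h => h) ?_
  have h1 : 1 ≤ N ^ k := Nat.one_le_pow _ _ hN
  have h2 : N ^ (k + 1) = N ^ k * N := pow_succ N k
  have h3 : N ≤ N ^ k * N := Nat.le_mul_of_pos_left _ h1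
  have h4 : N * (C * N ^ k + 2) = C * (N ^ k * N) + 2 * N := by ring
  rw [h2, h4]
  have h5 : (C + 3) * (N ^ k * N) = C * (N ^ k * N) + 3 * (N ^ k * N) := by ring
  omega

/-! ### The program -/

/-- The characteristic function of a candidate. -/
def kap (C : ℕ → ℕ → ℕ) (y z k v : ℕ) : ℕ := C y v * (k * C z v + (1 - k) * (1 - C z v))

/-- This is positive if `u`, `v`, `w` violate the definition of a simplicial clique. -/
def bad (C : ℕ → ℕ → ℕ) (κ : ℕ → ℕ) (u v w : ℕ) : ℕ :=
  κ u * (κ v * (1 - C u v) + C u v * C u w * (1 - κ v) * (1 - κ w) * (1 - C v w))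

/-- This is zero if and only if `κ` describes a simplicial clique containing `y`. -/
def defect (n : ℕ) (C : ℕ → ℕ → ℕ) (κ : ℕ → ℕ) (y : ℕ) : ℕ :=
  1 - κ y + ∑ u ∈ Finset.range n, ∑ v ∈ Finset.range n, ∑ w ∈ Finset.range n, bad C κ u v w

/-- `R[d]` times `n` plus `R[e]`: the address of an entry of the matrix, loaded into `R[t]`. -/
def entry (t d e : ℕ) : Program := [.mul 11 d 0, .add 11 11 e, .load t 11]

/-- Load the value at `R[d]` of the candidate into `R[t]`. -/
def member (t d : ℕ) : Program := [.add 11 10 d, .load t 11]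

/-- Write down the candidate described by the registers `3`, `4`, `5`. -/
def build : Code := loop 7 0 fun _ => entry 12 3 7 ++ entry 13 4 7 ++
  [.mul 14 5 13, .sub 15 1 5, .sub 16 1 13, .mul 15 15 16, .add 14 14 15, .mul 12 12 14,
    .add 11 10 7, .store 11 12]

/-- Add `bad` for the registers `6`, `7`, `8` to register `9`. -/
def checkTriple : Program :=
  entry 13 6 7 ++ entry 14 6 8 ++ entry 15 7 8 ++ member 16 6 ++ member 17 7 ++ member 18 8 ++
  [.sub 19 1 13, .mul 19 17 19, .sub 15 1 15, .sub 17 1 17, .sub 18 1 18, .mul 13 13 14,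
    .mul 13 13 17, .mul 13 13 18, .mul 13 13 15, .add 13 19 13, .mul 13 16 13, .add 9 9 13]

/-- Compute the defect of the candidate in register `9`. -/
def check : Code :=
  seq (fun _ => member 12 3 ++ [.sub 9 1 12]) (loop 6 0 (loop 7 0 (loop 8 0 fun _ => checkTriple)))

/-- Copy the registers `3`, `4`, `5` to `20`, `21`, `22` if register `9` is zero. -/
def save : Program :=
  [.sub 11 1 9, .sub 12 1 11, .mul 20 20 12, .mul 13 3 11, .add 20 20 13, .mul 21 21 12,
    .mul 13 4 11, .add 21 21 13, .mul 22 22 12, .mul 13 5 11, .add 22 22 13]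

/-- Set the registers for the constants, and the diagonal of the matrix to one. -/
def prepare : Code :=
  seq (fun _ => [.const 1 1, .const 2 2, .mul 10 0 0])
    (loop 6 0 fun _ => [.mul 11 6 0, .add 11 11 6, .store 11 1])

/-- Check the candidates one after the other, and write down one that passed. -/
def search : Code :=
  seq (seq prepare (loop 3 0 (loop 4 0 (loop 5 2 (seq (seq build check) fun _ => save)))))
    (seq (fun _ => [.mul 3 20 1, .mul 4 21 1, .mul 5 22 1]) build)

/-! ### Correctness and running time of the program -/

structure Base (n : ℕ) (C : ℕ → ℕ → ℕ) (r m : Regs) : Prop where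
  size : r 0 = n
  one : r 1 = 1
  two : r 2 = 2
  sq : r 10 = n * n
  mat : ∀ i < n, ∀ j < n, m (i * n + j) = C i j

/-- The contents of the registers while the candidate `y`, `z`, `k` is inspected. -/
structure Ctx (n : ℕ) (C : ℕ → ℕ → ℕ) (y z k y' z' k' : ℕ) (r m : Regs) : Prop extends
    Base n C r m where
  r3 : r 3 = y
  r4 : r 4 = z
  r5 : r 5 = k
  r20 : r 20 = y'
  r21 : r 21 = z'
  r22 : r 22 = k'

theorem Base.update {n : ℕ} {C : ℕ → ℕ → ℕ} {r m : Regs} (h : Base n C r m) {d v : ℕ}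
    (h0 : d ∉ [0, 1, 2, 10]) : Base n C (Function.update r d v) m := by
  simp only [List.mem_cons, List.not_mem_nil, or_false, not_or] at h0
  refine ⟨?_, ?_, ?_, ?_, h.mat⟩ <;> rw [Function.update_of_ne (by tauto)]
  exacts [h.size, h.one, h.two, h.sq]

theorem Ctx.update {n : ℕ} {C : ℕ → ℕ → ℕ} {y z k y' z' k' : ℕ} {r m : Regs}
    (h : Ctx n C y z k y' z' k' r m) {d v : ℕ}
    (h0 : d ∉ [0, 1, 2, 10, 3, 4, 5, 20, 21, 22]) :
    Ctx n C y z k y' z' k' (Function.update r d v) m := by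
  simp only [List.mem_cons, List.not_mem_nil, or_false, not_or] at h0
  refine ⟨h.toBase.update (by simp; tauto), ?_, ?_, ?_, ?_, ?_, ?_⟩ <;>
    rw [Function.update_of_ne (by tauto)]
  exacts [h.r3, h.r4, h.r5, h.r20, h.r21, h.r22]

variable {W n : ℕ} {C : ℕ → ℕ → ℕ}

theorem addr_lt {u v : ℕ} (hu : u < n) (hv : v < n) : u * n + v < n * n := by
  have := Nat.mul_le_mul_right n (Nat.succ_le_of_lt hu)
  rw [Nat.succ_mul] at this
  omega

theorem bounds (hW : 4 * n ^ 3 + 4 < W) (hn : 0 < n) :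
    n < W ∧ n * n + n < W ∧ 1 < W ∧ 2 < W := by
  have h1 : n * n ≤ n ^ 3 := by rw [pow_succ, sq]; exact Nat.le_mul_of_pos_right _ hn
  have h2 : n ≤ n * n := Nat.le_mul_of_pos_right _ hn
  omega

theorem mul_le_one' {a b : ℕ} (ha : a ≤ 1) (hb : b ≤ 1) : a * b ≤ 1 :=
  (Nat.mul_le_mul ha hb).trans (by norm_num)

theorem kap_le (hC : ∀ i < n, ∀ j < n, C i j ≤ 1) {y z k v : ℕ} (hy : y < n) (hz : z < n)
    (hk : k < 2) (hv : v < n) : kap C y z k v ≤ 1 := by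
  have h1 := hC y hy v hv
  have h2 := hC z hz v hv
  unfold kap
  refine mul_le_one' h1 ?_
  interval_cases k <;> (simp; try omega)

theorem triple_build (hW : 4 * n ^ 3 + 4 < W) (hn : 0 < n) (hC : ∀ i < n, ∀ j < n, C i j ≤ 1)
    {y z k y' z' k' : ℕ} (hy : y < n) (hz : z < n) (hk : k < 2) :
    Triple W (Ctx n C y z k y' z' k') build
      (fun r m => Ctx n C y z k y' z' k' r m ∧ ∀ v < n, m (n * n + v) = kap C y z k v)
      (17 * n ^ 1) := by
  obtain ⟨b1, b2, b3, b4⟩ := bounds hW hn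
  refine (triple_loop_pow (C := 14) (k := 0) (N := n) (I := fun i r m => Ctx n C y z k y' z' k' r m ∧
    ∀ v < i, m (n * n + v) = kap C y z k v) hn b1 ?_ ?_ ?_).conseq ?_ (fun _ _ h => h) le_rfl
  · exact fun i r m v h => ⟨h.1.update (by decide), h.2⟩
  · exact fun i r m h => ⟨h.1.one, h.1.size⟩
  · intro v hv
    refine (triple_block _).conseq ?_ (fun _ _ h => h) (by simp [entry])
    rintro r m ⟨⟨h, hκ⟩, hr⟩
    have e1 := h.mat y hy v hv
    have e2 := h.mat z hz v hv
    have a1 := addr_lt hy hv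
    have a2 := addr_lt hz hv
    have c1 := hC y hy v hv
    have c2 := hC z hz v hv
    have d1 : k * C z v + (1 - k) * (1 - C z v) ≤ 1 := by interval_cases k <;> (simp; try omega)
    have d2 : C y v * (k * C z v + (1 - k) * (1 - C z v)) ≤ 1 := mul_le_one' c1 d1
    simp only [entry, List.cons_append, List.nil_append, wp, Function.update_apply,
      Nat.reduceEqDiff, if_true, if_false, h.size, h.one, h.sq, h.r3, h.r4, h.r5,
      hr, e1, e2]
    refine ⟨by omega, by omega, by omega, by omega, by omega, by omega, by omega, by omega,
      by omega, by omega, by omega, by omega, by omega, ⟨?_, ?_⟩, ?_⟩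
    · have hb : Ctx n C y z k y' z' k' r
          (Function.update m (n * n + v) (C y v * (k * C z v + (1 - k) * (1 - C z v)))) := by
        refine ⟨⟨h.size, h.one, h.two, h.sq, fun i hi j hj => ?_⟩, h.r3, h.r4, h.r5, h.r20,
          h.r21, h.r22⟩
        have := addr_lt hi hj
        rw [Function.update_of_ne (by omega), h.mat i hi j hj]
      repeat refine Ctx.update ?_ (by decide)
      exact hb
    · intro w hw
      rcases Nat.lt_succ_iff_lt_or_eq.1 hw with hw | rfl
      · rw [if_neg (by omega), hκ w hw]
      · rw [if_pos rfl]; rfl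
    · trivial
  · exact fun r m h => ⟨h, by simp⟩

/-- The common form of the three nested loops of `check`, with register `9` as accumulator; the
bound `B` on the summands keeps every partial sum within a word. -/
theorem triple_sum {B c k a d : ℕ} {body : Code} {f : ℕ → ℕ} {J : Regs → Regs → Prop}
    (hn : 0 < n) (hnW : n < W) (hd : d ≠ 9) (hJ : ∀ r m v, J r m → J (Function.update r d v) m)
    (hJB : ∀ r m, J r m → Base n C r m) (hf : ∀ i < n, f i ≤ B) (ha : a + n * B < W)
    (hbody : ∀ i < n, ∀ a, a + B < W → Triple W (fun r m => (J r m ∧ r d = i) ∧ r 9 = a) body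
      (fun r m => (J r m ∧ r d = i) ∧ r 9 = a + f i) (c * n ^ k)) :
    Triple W (fun r m => J r m ∧ r 9 = a) (loop d 0 body)
      (fun r m => J r m ∧ r 9 = a + ∑ i ∈ Finset.range n, f i) ((c + 3) * n ^ (k + 1)) := by
  refine (triple_loop_pow (C := c) (k := k) (N := n)
    (I := fun i r m => J r m ∧ r 9 = a + ∑ i ∈ Finset.range i, f i) hn hnW ?_ ?_ ?_).conseq
    ?_ (fun _ _ h => h) le_rfl
  · exact fun i r m v h => ⟨hJ r m v h.1, by rw [Function.update_of_ne hd.symm]; exact h.2⟩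
  · exact fun i r m h => ⟨(hJB r m h.1).one, (hJB r m h.1).size⟩
  · intro i hi
    refine (hbody i hi (a + ∑ i ∈ Finset.range i, f i) ?_).conseq
      (fun r m h => ⟨⟨h.1.1, h.2⟩, h.1.2⟩) (fun r m h => ⟨⟨h.1.1, ?_⟩, h.1.2⟩) le_rfl
    · have h1 : ∑ j ∈ Finset.range i, f j ≤ i * B := by
        simpa using Finset.sum_le_card_nsmul (Finset.range i) f B fun j hj =>
          hf j (by simp at hj; omega)
      have h2 : (i + 1) * B ≤ n * B := Nat.mul_le_mul_right _ hi
      rw [Nat.succ_mul] at h2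
      omega
    · rw [h.2, Finset.sum_range_succ, Nat.add_assoc]
  · exact fun r m h => ⟨h.1, by simpa using h.2⟩

/-- As `Ctx`, with the candidate `κ` written down. -/
def CtxK (n : ℕ) (C : ℕ → ℕ → ℕ) (κ : ℕ → ℕ) (y z k y' z' k' : ℕ) (r m : Regs) : Prop :=
  Ctx n C y z k y' z' k' r m ∧ ∀ v < n, m (n * n + v) = κ v

theorem bad_le (hC : ∀ i < n, ∀ j < n, C i j ≤ 1) {κ : ℕ → ℕ} (hκ : ∀ v < n, κ v ≤ 1) {u v w : ℕ}
    (hu : u < n) (hv : v < n) (hw : w < n) : bad C κ u v w ≤ 2 := by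
  unfold bad
  have h1 : κ v * (1 - C u v) ≤ 1 := mul_le_one' (hκ v hv) (by omega)
  have h2 : C u v * C u w * (1 - κ v) * (1 - κ w) * (1 - C v w) ≤ 1 :=
    mul_le_one' (mul_le_one' (mul_le_one' (mul_le_one' (hC u hu v hv) (hC u hu w hw)) (by omega))
      (by omega)) (by omega)
  calc _ ≤ 1 * 2 := Nat.mul_le_mul (hκ u hu) (by omega)
    _ = 2 := rfl

theorem triple_checkTriple (hW : 4 * n ^ 3 + 4 < W) (hn : 0 < n)
    (hC : ∀ i < n, ∀ j < n, C i j ≤ 1) {κ : ℕ → ℕ} (hκ : ∀ v < n, κ v ≤ 1) {y z k y' z' k' u v w : ℕ}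
    (hu : u < n) (hv : v < n) (hw : w < n) {a : ℕ} (ha : a + 2 < W) :
    Triple W
      (fun r m => (((CtxK n C κ y z k y' z' k' r m ∧ r 6 = u) ∧ r 7 = v) ∧ r 8 = w) ∧ r 9 = a)
      (fun _ => checkTriple)
      (fun r m => (((CtxK n C κ y z k y' z' k' r m ∧ r 6 = u) ∧ r 7 = v) ∧ r 8 = w) ∧
        r 9 = a + bad C κ u v w) 27 := by
  obtain ⟨b1, b2, b3, b4⟩ := bounds hW hn
  refine (triple_block _).conseq ?_ (fun _ _ h => h) (by simp [checkTriple, entry, member])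
  rintro r m ⟨⟨⟨⟨⟨h, hm⟩, h6⟩, h7⟩, h8⟩, h9⟩
  have e1 := h.mat u hu v hv
  have e2 := h.mat u hu w hw
  have e3 := h.mat v hv w hw
  have e4 := hm u hu
  have e5 := hm v hv
  have e6 := hm w hw
  have a1 := addr_lt hu hv
  have a2 := addr_lt hu hw
  have a3 := addr_lt hv hw
  have c1 := hC u hu v hv
  have c2 := hC u hu w hw
  have c3 := hC v hv w hw
  have k1 := hκ u hu
  have k2 := hκ v hv
  have k3 := hκ w hw
  have d1 : κ v * (1 - C u v) ≤ 1 := mul_le_one' k2 (by omega)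
  have d2 : C u v * C u w ≤ 1 := mul_le_one' c1 c2
  have d3 : C u v * C u w * (1 - κ v) ≤ 1 := mul_le_one' d2 (by omega)
  have d4 : C u v * C u w * (1 - κ v) * (1 - κ w) ≤ 1 := mul_le_one' d3 (by omega)
  have d5 : C u v * C u w * (1 - κ v) * (1 - κ w) * (1 - C v w) ≤ 1 := mul_le_one' d4 (by omega)
  have d6 : κ u * (κ v * (1 - C u v) + C u v * C u w * (1 - κ v) * (1 - κ w) * (1 - C v w)) ≤ 2 :=
    bad_le hC hκ hu hv hw
  simp only [checkTriple, entry, member, List.cons_append, List.nil_append, wp,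
    Function.update_apply, Nat.reduceEqDiff, if_true, if_false, h.size, h.one, h.sq, h6, h7, h8, h9,
    e1, e2, e3, e4, e5, e6]
  refine ⟨by omega, by omega, by omega, by omega, by omega, by omega, by omega, by omega, by omega,
    by omega, by omega, by omega, by omega, by omega, by omega, by omega, by omega, by omega,
    by omega, by omega, by omega, by omega, by omega, by omega, by omega, by omega, by omega,
    ⟨⟨⟨⟨?_, hm⟩, trivial⟩, trivial⟩, trivial⟩, rfl⟩
  repeat refine Ctx.update ?_ (by decide)
  exact h

theorem triple_check (hW : 4 * n ^ 3 + 4 < W) (hn : 0 < n) (hC : ∀ i < n, ∀ j < n, C i j ≤ 1)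
    {κ : ℕ → ℕ} (hκ : ∀ v < n, κ v ≤ 1) {y z k y' z' k' : ℕ} (hy : y < n) :
    Triple W (CtxK n C κ y z k y' z' k') check
      (fun r m => CtxK n C κ y z k y' z' k' r m ∧ r 9 = defect n C κ y) (39 * n ^ 3) := by
  obtain ⟨b1, b2, b3, b4⟩ := bounds hW hn
  have hn3 : 1 ≤ n ^ 3 := Nat.one_le_pow _ _ hn
  have hup : ∀ d v r m, d ∉ [0, 1, 2, 10, 3, 4, 5, 20, 21, 22] → CtxK n C κ y z k y' z' k' r m →
      CtxK n C κ y z k y' z' k' (Function.update r d v) m :=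
    fun d v r m hd h => ⟨h.1.update hd, h.2⟩
  have q1 : ∀ u < n, ∀ v < n, ∑ w ∈ Finset.range n, bad C κ u v w ≤ n * 2 := fun u hu v hv => by
    simpa using Finset.sum_le_card_nsmul (Finset.range n) (bad C κ u v) 2 fun w hw =>
      bad_le hC hκ hu hv (by simpa using hw)
  have q2 : ∀ u < n, ∑ v ∈ Finset.range n, ∑ w ∈ Finset.range n, bad C κ u v w ≤ n * (n * 2) :=
    fun u hu => by
      simpa using Finset.sum_le_card_nsmul (Finset.range n) _ (n * 2) fun v hv =>
        q1 u hu v (by simpa using hv)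
  have s1 : Triple W (CtxK n C κ y z k y' z' k') (fun _ => member 12 3 ++ [.sub 9 1 12])
      (fun r m => CtxK n C κ y z k y' z' k' r m ∧ r 9 = 1 - κ y) 3 := by
    refine (triple_block _).conseq ?_ (fun _ _ h => h) (by simp [member])
    rintro r m ⟨h, hm⟩
    have e1 := hm y hy
    have k1 := hκ y hy
    simp only [member, List.cons_append, List.nil_append, wp, Function.update_apply,
      Nat.reduceEqDiff, if_true, if_false, h.one, h.sq, h.r3, e1]
    refine ⟨by omega, by omega, by omega, ⟨?_, hm⟩, trivial⟩
    repeat refine Ctx.update ?_ (by decide)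
    exact h
  have s2 := triple_sum (W := W) (n := n) (C := C) (B := n * (n * 2)) (c := 33) (k := 2)
    (a := 1 - κ y) (d := 6) (body := loop 7 0 (loop 8 0 fun _ => checkTriple))
    (f := fun u => ∑ v ∈ Finset.range n, ∑ w ∈ Finset.range n, bad C κ u v w)
    (J := CtxK n C κ y z k y' z' k') hn b1 (by decide) (fun r m v => hup 6 v r m (by decide))
    (fun r m h => h.1.toBase) q2 (by
      have : n * (n * (n * 2)) = 2 * n ^ 3 := by ring
      omega)
  refine (s1.seq (s2 fun u hu a ha => ?_)).conseq (fun _ _ h => h) (fun _ _ h => h) ?_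
  · refine triple_sum (W := W) (n := n) (C := C) (B := n * 2) (c := 30) (k := 1) (a := a) (d := 7)
      (body := loop 8 0 fun _ => checkTriple)
      (f := fun v => ∑ w ∈ Finset.range n, bad C κ u v w)
      (J := fun r m => CtxK n C κ y z k y' z' k' r m ∧ r 6 = u) hn b1 (by decide)
      (fun r m v h => ⟨hup 7 v r m (by decide) h.1, by simpa [Function.update_apply] using h.2⟩)
      (fun r m h => h.1.1.toBase) (q1 u hu) ha fun v hv a ha => ?_
    refine triple_sum (W := W) (n := n) (C := C) (B := 2) (c := 27) (k := 0) (a := a) (d := 8)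
      (body := fun _ => checkTriple) (f := fun w => bad C κ u v w)
      (J := fun r m => (CtxK n C κ y z k y' z' k' r m ∧ r 6 = u) ∧ r 7 = v) hn b1 (by decide)
      (fun r m v h => ⟨⟨hup 8 v r m (by decide) h.1.1, by simpa [Function.update_apply] using h.1.2⟩,
        by simpa [Function.update_apply] using h.2⟩)
      (fun r m h => h.1.1.1.toBase) (fun w hw => bad_le hC hκ hu hv hw) ha fun w hw a ha => ?_
    exact (triple_checkTriple hW hn hC hκ hu hv hw ha).conseq (fun _ _ h => h) (fun _ _ h => h)
      (by simp)
  · simp only [Nat.reduceAdd]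
    omega

/-- The selection is branch-free: `1 - δ` is the indicator of `δ = 0`, and the saved values are
multiplied by its complement before the new ones are added with it. -/
theorem triple_save (hW : 4 * n ^ 3 + 4 < W) (hn : 0 < n) {y z k y' z' k' δ : ℕ} (hy : y < n)
    (hz : z < n) (hk : k < 2) (hy' : y' < n) (hz' : z' < n) (hk' : k' < 2) :
    Triple W (fun r m => Ctx n C y z k y' z' k' r m ∧ r 9 = δ) (fun _ => save)
      (Ctx n C y z k (if δ = 0 then y else y') (if δ = 0 then z else z')
        (if δ = 0 then k else k')) 11 := by
  obtain ⟨b1, b2, b3, b4⟩ := bounds hW hn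
  refine (triple_block _).conseq ?_ (fun _ _ h => h) (by simp [save])
  rintro r m ⟨h, h9⟩
  rcases Nat.eq_zero_or_pos δ with h0 | h0
  · subst h0
    simp only [save, wp, Function.update_apply, Nat.reduceEqDiff, if_true, if_false, h.one,
      h.r3, h.r4, h.r5, h.r20, h.r21, h.r22, h9, Nat.sub_zero, Nat.sub_self, Nat.mul_zero,
      Nat.mul_one, Nat.zero_add]
    refine ⟨by omega, by omega, by omega, by omega, by omega, by omega, by omega, by omega,
      by omega, by omega, by omega, ⟨?_, ?_, ?_, ?_, ?_, ?_, ?_⟩⟩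
    · repeat refine Base.update ?_ (by decide)
      exact h.toBase
    all_goals simp [h.r3, h.r4, h.r5]
  · have h1 : 1 - δ = 0 := by omega
    have h2 : δ ≠ 0 := by omega
    simp only [save, wp, Function.update_apply, Nat.reduceEqDiff, if_true, if_false, h.one,
      h.r3, h.r4, h.r5, h.r20, h.r21, h.r22, h9, h1, h2, Nat.sub_zero, Nat.mul_zero,
      Nat.mul_one, Nat.add_zero]
    refine ⟨by omega, by omega, by omega, by omega, by omega, by omega, by omega, by omega,
      by omega, by omega, by omega, ⟨?_, ?_, ?_, ?_, ?_, ?_, ?_⟩⟩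
    · repeat refine Base.update ?_ (by decide)
      exact h.toBase
    all_goals simp [h.r3, h.r4, h.r5]

theorem addr_inj {i j u v : ℕ} (hj : j < n) (hv : v < n) (h : i * n + j = u * n + v) :
    i = u ∧ j = v := by
  have hn : 0 < n := by omega
  have h1 : (j + n * i) / n = (v + n * u) / n := by rw [mul_comm n i, mul_comm n u]; congr 1; omega
  rw [Nat.add_mul_div_left _ _ hn, Nat.add_mul_div_left _ _ hn, Nat.div_eq_of_lt hj,
    Nat.div_eq_of_lt hv] at h1
  obtain rfl : i = u := by omega
  exact ⟨rfl, by omega⟩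

theorem triple_prepare (hW : 4 * n ^ 3 + 4 < W) (hn : 0 < n) {A : ℕ → ℕ → ℕ} :
    Triple W (fun r m => (∀ x, r x = if x = 0 then n else 0) ∧
        ∀ i < n, ∀ j < n, m (i * n + j) = A i j) prepare
      (fun r m => Base n (fun i j => if i = j then 1 else A i j) r m ∧
        r 20 = 0 ∧ r 21 = 0 ∧ r 22 = 0) (3 + 6 * n ^ 1) := by
  obtain ⟨b1, b2, b3, b4⟩ := bounds hW hn
  let I : ℕ → Regs → Regs → Prop := fun t r m =>
    Base n (fun i j => if i = j ∧ i < t then 1 else A i j) r m ∧ r 20 = 0 ∧ r 21 = 0 ∧ r 22 = 0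
  have s1 : Triple W (fun r m => (∀ x, r x = if x = 0 then n else 0) ∧
        ∀ i < n, ∀ j < n, m (i * n + j) = A i j)
      (fun _ => [.const 1 1, .const 2 2, .mul 10 0 0]) (I 0) 3 := by
    refine (triple_block _).conseq ?_ (fun _ _ h => h) (by simp)
    rintro r m ⟨hr, hm⟩
    have h0 : r 0 = n := by simp [hr]
    simp only [wp, Function.update_apply, if_false, h0, Nat.reduceEqDiff]
    refine ⟨b3, b4, by omega, ⟨?_, ?_, ?_, ?_, ?_⟩, ?_, ?_, ?_⟩
    all_goals simp [hr]
    exact hm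
  have s2 : Triple W (I 0) (loop 6 0 fun _ => [.mul 11 6 0, .add 11 11 6, .store 11 1]) (I n)
      ((3 + 3) * n ^ (0 + 1)) := by
    refine triple_loop_pow hn b1 ?_ (fun i r m h => ⟨h.1.one, h.1.size⟩) ?_
    · rintro i r m v ⟨h, h1⟩
      exact ⟨h.update (by decide), by simpa [Function.update_apply] using h1⟩
    · intro t ht
      refine (triple_block _).conseq ?_ (fun _ _ h => h) (by simp)
      rintro r m ⟨⟨h, h1⟩, h6⟩
      have a1 := addr_lt ht ht
      have hb : Base n (fun i j => if i = j ∧ i < t + 1 then 1 else A i j) r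
          (Function.update m (t * n + t) 1) := by
        refine ⟨h.size, h.one, h.two, h.sq, fun i hi j hj => ?_⟩
        rw [Function.update_apply]
        by_cases he : i * n + j = t * n + t
        · obtain ⟨rfl, rfl⟩ := addr_inj hj ht he
          simp
        · have : ¬ (i = j ∧ i = t) := by rintro ⟨rfl, rfl⟩; exact he rfl
          rw [if_neg he, h.mat i hi j hj]
          congr 1
          apply propext
          omega
      simp only [wp, Function.update_apply, Nat.reduceEqDiff, if_true, if_false, h.size, h.one, h6]
      refine ⟨by omega, by omega, ⟨?_, ?_⟩, ?_⟩
      · repeat refine Base.update ?_ (by decide)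
        exact hb
      · simpa [Function.update_apply] using h1
      · trivial
  refine (s1.seq s2).conseq (fun _ _ h => h) ?_ le_rfl
  rintro r m ⟨h, h1⟩
  refine ⟨⟨h.size, h.one, h.two, h.sq, fun i hi j hj => ?_⟩, h1⟩
  rw [h.mat i hi j hj]
  simp [hi]

/-- Among the candidates in `F` there is none without defect, unless the saved one is. -/
structure Saved (n : ℕ) (C : ℕ → ℕ → ℕ) (F : ℕ → ℕ → ℕ → Prop) (y' z' k' : ℕ) : Prop where
  y_lt : y' < n
  z_lt : z' < n
  k_lt : k' < 2
  defect : ∀ y < n, ∀ z < n, ∀ k < 2, F y z k → defect n C (kap C y z k) y = 0 →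
    defect n C (kap C y' z' k') y' = 0

theorem Saved.mono {F F' : ℕ → ℕ → ℕ → Prop} {y' z' k' : ℕ} (h : Saved n C F y' z' k')
    (hF : ∀ y < n, ∀ z < n, ∀ k < 2, F' y z k → F y z k) : Saved n C F' y' z' k' :=
  ⟨h.y_lt, h.z_lt, h.k_lt, fun y hy z hz k hk h' => h.defect y hy z hz k hk (hF y hy z hz k hk h')⟩

/-- The loop invariant of the search: the candidates in `F` have been inspected. -/
def Inv (n : ℕ) (C : ℕ → ℕ → ℕ) (F : ℕ → ℕ → ℕ → Prop) (r m : Regs) : Prop :=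
  Base n C r m ∧ Saved n C F (r 20) (r 21) (r 22)

theorem Inv.update {F : ℕ → ℕ → ℕ → Prop} {r m : Regs} {d v : ℕ} (h : Inv n C F r m)
    (hd : d ∉ [0, 1, 2, 10, 20, 21, 22]) : Inv n C F (Function.update r d v) m := by
  simp only [List.mem_cons, List.not_mem_nil, or_false, not_or] at hd
  refine ⟨h.1.update (by simp; tauto), ?_⟩
  rw [Function.update_of_ne (by tauto), Function.update_of_ne (by tauto),
    Function.update_of_ne (by tauto)]
  exact h.2

theorem triple_step (hW : 4 * n ^ 3 + 4 < W) (hn : 0 < n) (hC : ∀ i < n, ∀ j < n, C i j ≤ 1)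
    {F : ℕ → ℕ → ℕ → Prop} {y z k : ℕ} (hy : y < n) (hz : z < n) (hk : k < 2) :
    Triple W (fun r m => ((Inv n C F r m ∧ r 3 = y) ∧ r 4 = z) ∧ r 5 = k)
      (seq (seq build check) fun _ => save)
      (fun r m => ((Inv n C (fun a b c => F a b c ∨ (a = y ∧ b = z ∧ c = k)) r m ∧ r 3 = y) ∧
        r 4 = z) ∧ r 5 = k) (67 * n ^ 3) := by
  rintro P l r m hc ⟨⟨⟨⟨hB, hS⟩, h3⟩, h4⟩, h5⟩
  have hκ : ∀ v < n, kap C y z k v ≤ 1 := fun v hv => kap_le hC hy hz hk hv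
  have T := ((triple_build hW hn hC (y' := r 20) (z' := r 21) (k' := r 22) hy hz hk).seq
    (triple_check hW hn hC hκ hy)).seq
    ((triple_save (C := C) (δ := defect n C (kap C y z k) y) hW hn hy hz hk hS.y_lt hS.z_lt
      hS.k_lt).conseq (fun _ _ h => ⟨h.1.1, h.2⟩) (fun _ _ h => h) le_rfl)
  obtain ⟨t, ht, r', m', hs, h⟩ := T P l r m hc ⟨hB, h3, h4, h5, rfl, rfl, rfl⟩
  have h1 : 1 ≤ n ^ 3 := Nat.one_le_pow _ _ hn
  have h2 : n ^ 1 ≤ n ^ 3 := Nat.pow_le_pow_right hn (by norm_num)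
  refine ⟨t, by omega, r', m', hs, ⟨⟨⟨h.toBase, ?_⟩, h.r3⟩, h.r4⟩, h.r5⟩
  rw [h.r20, h.r21, h.r22]
  by_cases hδ : defect n C (kap C y z k) y = 0
  · simp only [hδ, if_true]
    exact ⟨hy, hz, hk, fun _ _ _ _ _ _ _ _ => hδ⟩
  · simp only [hδ, if_false]
    refine ⟨hS.y_lt, hS.z_lt, hS.k_lt, fun a ha b hb c hc hF h0 => ?_⟩
    rcases hF with hF | ⟨rfl, rfl, rfl⟩
    · exact hS.defect a ha b hb c hc hF h0
    · exact absurd h0 hδ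

theorem triple_search (hW : 4 * n ^ 3 + 4 < W) (hn : 0 < n) {A : ℕ → ℕ → ℕ}
    (hC : ∀ i < n, ∀ j < n, (if i = j then 1 else A i j) ≤ 1) :
    Triple W (fun r m => (∀ x, r x = if x = 0 then n else 0) ∧
        ∀ i < n, ∀ j < n, m (i * n + j) = A i j) search
      (fun _ m => ∃ y z k, Saved n (fun i j => if i = j then 1 else A i j) (fun _ _ _ => True) y z k ∧
        ∀ v < n, m (n * n + v) = kap (fun i j => if i = j then 1 else A i j) y z k v)
      (200 * n ^ 5) := by
  obtain ⟨b1, b2, b3, b4⟩ := bounds hW hn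
  generalize hCA : (fun i j => if i = j then 1 else A i j) = C
  have hC : ∀ i < n, ∀ j < n, C i j ≤ 1 := by subst hCA; exact hC
  have s1 := triple_prepare hW hn (A := A)
  rw [hCA] at s1
  have s2 : ∀ y < n, ∀ z < n, Triple W
      (fun r m => (Inv n C (fun a b _ => a < y ∨ (a = y ∧ b < z)) r m ∧ r 3 = y) ∧ r 4 = z)
      (loop 5 2 (seq (seq build check) fun _ => save))
      (fun r m => (Inv n C (fun a b _ => a < y ∨ (a = y ∧ b < z + 1)) r m ∧ r 3 = y) ∧ r 4 = z)
      (139 * n ^ 3) := by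
    intro y hy z hz
    have h1 : 1 ≤ n ^ 3 := Nat.one_le_pow _ _ hn
    refine (triple_loop (N := 2) (T := 67 * n ^ 3) (I := fun i r m =>
      (Inv n C (fun a b c => a < y ∨ (a = y ∧ (b < z ∨ (b = z ∧ c < i)))) r m ∧ r 3 = y) ∧ r 4 = z)
      -- The invariants say that the candidates preceding the current one lexicographically have
      -- been inspected.
      (by norm_num) b4 ?_ ?_ ?_).conseq ?_ ?_ (by omega)
    · rintro i r m v ⟨⟨h1, h2⟩, h3⟩
      exact ⟨⟨h1.update (by decide), by simpa [Function.update_apply] using h2⟩,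
        by simpa [Function.update_apply] using h3⟩
    · exact fun i r m h => ⟨h.1.1.1.one, h.1.1.1.two⟩
    · intro k hk
      refine (triple_step hW hn hC hy hz hk).conseq (fun _ _ h => h) ?_ le_rfl
      rintro r m ⟨⟨⟨⟨hB, hS⟩, h3⟩, h4⟩, h5⟩
      refine ⟨⟨⟨⟨hB, hS.mono ?_⟩, h3⟩, h4⟩, h5⟩
      intros; omega
    · rintro r m ⟨⟨⟨hB, hS⟩, h3⟩, h4⟩
      refine ⟨⟨⟨hB, hS.mono ?_⟩, h3⟩, h4⟩
      intros; omega
    · rintro r m ⟨⟨⟨hB, hS⟩, h3⟩, h4⟩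
      refine ⟨⟨⟨hB, hS.mono ?_⟩, h3⟩, h4⟩
      intros; omega
  have s3 : ∀ y < n, Triple W (fun r m => Inv n C (fun a _ _ => a < y) r m ∧ r 3 = y)
      (loop 4 0 (loop 5 2 (seq (seq build check) fun _ => save)))
      (fun r m => Inv n C (fun a _ _ => a < y + 1) r m ∧ r 3 = y) (142 * n ^ 4) := by
    intro y hy
    refine (triple_loop_pow (C := 139) (k := 3) (I := fun i r m =>
      Inv n C (fun a b _ => a < y ∨ (a = y ∧ b < i)) r m ∧ r 3 = y) hn b1 ?_ ?_ (s2 y hy)).conseq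
      ?_ ?_ le_rfl
    · rintro i r m v ⟨h1, h2⟩
      exact ⟨h1.update (by decide), by simpa [Function.update_apply] using h2⟩
    · exact fun i r m h => ⟨h.1.1.one, h.1.1.size⟩
    · rintro r m ⟨⟨hB, hS⟩, h3⟩
      refine ⟨⟨hB, hS.mono ?_⟩, h3⟩
      intros; omega
    · rintro r m ⟨⟨hB, hS⟩, h3⟩
      refine ⟨⟨hB, hS.mono ?_⟩, h3⟩
      intros; omega
  have s4 := triple_loop_pow (C := 142) (k := 4) (I := fun i r m => Inv n C (fun a _ _ => a < i) r m)
    hn b1 (fun i r m v h => h.update (by decide)) (fun i r m h => ⟨h.1.one, h.1.size⟩) s3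
  have s5 : Triple W (fun r m => Inv n C (fun a _ _ => a < n) r m)
      (fun _ => [.mul 3 20 1, .mul 4 21 1, .mul 5 22 1])
      (fun r m => ∃ y z k, Saved n C (fun _ _ _ => True) y z k ∧ Ctx n C y z k y z k r m) 3 := by
    refine (triple_block _).conseq ?_ (fun _ _ h => h) (by simp)
    rintro r m ⟨h, hS⟩
    have q1 := hS.y_lt
    have q2 := hS.z_lt
    have q3 := hS.k_lt
    simp only [wp, Function.update_apply, Nat.reduceEqDiff, if_false, h.one, Nat.mul_one]
    refine ⟨by omega, by omega, by omega, r 20, r 21, r 22, hS.mono (fun y hy _ _ _ _ _ => hy),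
      ?_, ?_, ?_, ?_, ?_, ?_, ?_⟩
    · repeat refine Base.update ?_ (by decide)
      exact h
    all_goals simp
  have s6 : Triple W (fun r m => ∃ y z k, Saved n C (fun _ _ _ => True) y z k ∧
      Ctx n C y z k y z k r m) build (fun _ m => ∃ y z k, Saved n C (fun _ _ _ => True) y z k ∧
        ∀ v < n, m (n * n + v) = kap C y z k v) (17 * n ^ 1) := by
    rintro P l r m hc ⟨y, z, k, hS, h⟩
    obtain ⟨t, ht, r', m', hs, h'⟩ := triple_build hW hn hC hS.y_lt hS.z_lt hS.k_lt P l r m hc h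
    exact ⟨t, ht, r', m', hs, y, z, k, hS, h'.2⟩
  have h1 : 1 ≤ n ^ 5 := Nat.one_le_pow _ _ hn
  have h2 : n ^ 1 ≤ n ^ 5 := Nat.pow_le_pow_right hn (by norm_num)
  refine ((s1.seq (s4.conseq ?_ (fun _ _ h => h) le_rfl)).seq (s5.seq s6)).conseq
    (fun _ _ h => h) (fun _ _ h => h) (by simp only [Nat.reduceAdd]; omega)
  rintro r m ⟨h, h20, h21, h22⟩
  refine ⟨h, ?_⟩
  rw [h20, h21, h22]
  exact ⟨hn, hn, by norm_num, fun y _ z _ k _ hy => absurd hy (Nat.not_lt_zero y)⟩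

end WordRAM

/-! ### From the machine back to the graph -/

namespace WordRAM
open CleanGraph

open Classical in
/-- The entries of the adjacency matrix of `G`. -/
noncomputable def adjEntry {n : ℕ} (G : SimpleGraph (Fin n)) (i j : ℕ) : ℕ :=
  if ∃ (hi : i < n) (hj : j < n), G.Adj ⟨i, hi⟩ ⟨j, hj⟩ then 1 else 0

/-- The entries of the adjacency matrix of `G` with ones on the diagonal. -/
noncomputable def closedEntry {n : ℕ} (G : SimpleGraph (Fin n)) (i j : ℕ) : ℕ :=
  if i = j then 1 else adjEntry G i j

variable {n : ℕ} {G : SimpleGraph (Fin n)}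

theorem closedEntry_le (i j : ℕ) : closedEntry G i j ≤ 1 := by
  unfold closedEntry adjEntry
  split_ifs <;> simp

theorem closedEntry_eq_one (i j : Fin n) : closedEntry G i j = 1 ↔ j = i ∨ G.Adj i j := by
  unfold closedEntry adjEntry
  by_cases h : i = j
  · simp [h]
  · have h' : (i : ℕ) ≠ j := fun e => h (Fin.ext e)
    simp [h', Ne.symm h]

theorem init_mem (i j : ℕ) (hi : i < n) (hj : j < n) :
    (init G).mem (i * n + j) = adjEntry G i j := by
  classical
  simp only [init, adjEntry]
  congr 1
  apply propext
  constructor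
  · rintro ⟨u, v, h, hadj⟩
    obtain ⟨rfl, rfl⟩ := addr_inj hj v.2 h
    exact ⟨hi, hj, hadj⟩
  · rintro ⟨hi, hj, hadj⟩
    exact ⟨⟨i, hi⟩, ⟨j, hj⟩, rfl, hadj⟩

theorem eq_zero_of_le_one {a : ℕ} (h : a ≤ 1) (h' : a ≠ 1) : a = 0 := by omega

theorem kap_eq_one (y z v : Fin n) {k : ℕ} (hk : k < 2) :
    kap (closedEntry G) y z k v = 1 ↔ v ∈ cand G y z (k = 1) := by
  have hz := closedEntry_le (G := G) z v
  have hy := closedEntry_le (G := G) y v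
  simp only [cand, Set.mem_ofPred_eq, ← closedEntry_eq_one, kap]
  generalize closedEntry G z v = a at *
  generalize closedEntry G y v = b at *
  interval_cases k <;> interval_cases a <;> interval_cases b <;> simp

theorem isSimplicialClique_of_defect {κ : ℕ → ℕ} (hκ : ∀ v < n, κ v ≤ 1) {y : Fin n}
    (h : defect n (closedEntry G) κ y = 0) : IsSimplicialClique G {v | κ v = 1} := by
  simp only [defect, Nat.add_eq_zero_iff, Finset.sum_eq_zero_iff, Finset.mem_range] at h
  obtain ⟨hy, hbad⟩ := h
  have hbad : ∀ u v w : Fin n, bad (closedEntry G) κ u v w = 0 := fun u v w =>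
    hbad u u.2 v v.2 w w.2
  have hy1 : κ y = 1 := by have := hκ y y.2; omega
  refine ⟨⟨y, hy1⟩, ?_, ?_⟩
  · intro u hu v hv huv
    have hu : κ u = 1 := hu
    have hv : κ v = 1 := hv
    by_contra hn
    have h0 : closedEntry G u v = 0 := eq_zero_of_le_one (closedEntry_le _ _) (by
      rw [Ne, closedEntry_eq_one]
      rintro (h | h)
      exacts [huv h.symm, hn h])
    have := hbad u v v
    simp [bad, hu, hv, h0] at this
  · rintro v hv u ⟨hvu, hu⟩ w ⟨hvw, hw⟩ huw
    have hv : κ v = 1 := hv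
    have hu : κ u = 0 := eq_zero_of_le_one (hκ u u.2) hu
    have hw : κ w = 0 := eq_zero_of_le_one (hκ w w.2) hw
    have e1 : closedEntry G v u = 1 := (closedEntry_eq_one v u).2 (Or.inr hvu)
    have e2 : closedEntry G v w = 1 := (closedEntry_eq_one v w).2 (Or.inr hvw)
    by_contra hn
    have h0 : closedEntry G u w = 0 := eq_zero_of_le_one (closedEntry_le _ _) (by
      rw [Ne, closedEntry_eq_one]
      rintro (h | h)
      exacts [huw h.symm, hn h])
    have := hbad v u w
    simp [bad, hu, hv, hw, e1, e2, h0] at this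

theorem defect_of_isSimplicialClique {κ : ℕ → ℕ} (hκ : ∀ v < n, κ v ≤ 1) {y : Fin n}
    (hy : κ y = 1) (h : IsSimplicialClique G {v | κ v = 1}) :
    defect n (closedEntry G) κ y = 0 := by
  obtain ⟨-, hcl, hsim⟩ := h
  simp only [defect, Nat.add_eq_zero_iff, Finset.sum_eq_zero_iff, Finset.mem_range]
  refine ⟨by omega, fun u hu v hv w hw => ?_⟩
  lift u to Fin n using hu
  lift v to Fin n using hv
  lift w to Fin n using hw
  simp only [bad, mul_eq_zero, Nat.add_eq_zero_iff]
  by_cases hu : κ u = 1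
  swap
  · exact Or.inl (eq_zero_of_le_one (hκ u u.2) hu)
  right
  have hce : ∀ i j : Fin n, 1 - closedEntry G i j = 0 ↔ j = i ∨ G.Adj i j := fun i j => by
    rw [← closedEntry_eq_one]
    have := closedEntry_le (G := G) i j
    omega
  have hce0 : ∀ i j : Fin n, closedEntry G i j = 0 ↔ ¬ (j = i ∨ G.Adj i j) := fun i j => by
    rw [← closedEntry_eq_one]
    have := closedEntry_le (G := G) i j
    omega
  rw [hce, hce, hce0, hce0]
  constructor
  · by_cases hv : κ v = 1
    · right
      by_cases huv : v = u
      · exact Or.inl huv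
      · exact Or.inr (hcl hu hv (Ne.symm huv))
    · exact Or.inl (eq_zero_of_le_one (hκ v v.2) hv)
  · by_cases hv : κ v = 1
    · simp [hv]
    by_cases hw : κ w = 1
    · simp [hw]
    have hvu : v ≠ u := by rintro rfl; exact hv hu
    have hwu : w ≠ u := by rintro rfl; exact hw hu
    by_cases h1 : G.Adj u v
    · by_cases h2 : G.Adj u w
      · right
        by_cases hvw : w = v
        · exact Or.inl hvw
        · exact Or.inr (hsim u hu ⟨h1, hv⟩ ⟨h2, hw⟩ (Ne.symm hvw))
      · simp [hwu, h2]
    · simp [hvu, h1]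

/-- By `exists_good` some candidate has defect zero, so the saved one has defect zero too, and the
set written down is a simplicial clique. -/
theorem computes_search (hn : 0 < n) (hG : IsClean G) :
    ∃ K : Set (Fin n), IsSimplicialClique G K ∧
      Computes (8 * Nat.size n) (search 0) G (200 * n ^ 5) K := by
  -- A word must hold the addresses below n² + n and the defect, which is at most 1 + 2n³. Eight
  -- times the bit length of n suffices, since n + 1 ≤ 2 ^ `Nat.size n`.
  have hW : 4 * n ^ 3 + 4 < 2 ^ (8 * Nat.size n) := by
    have h1 : n + 1 ≤ 2 ^ Nat.size n := Nat.lt_size_self n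
    have h2 : (n + 1) ^ 8 ≤ 2 ^ (8 * Nat.size n) := by
      rw [mul_comm 8, pow_mul]
      exact Nat.pow_le_pow_left h1 8
    refine lt_of_lt_of_le ?_ h2
    have h3 : 2 ≤ n + 1 := by omega
    have h4 : 2 ^ 5 ≤ (n + 1) ^ 5 := Nat.pow_le_pow_left h3 5
    have h5 : n ^ 3 < (n + 1) ^ 3 := Nat.pow_lt_pow_left (Nat.lt_succ_self n) (by norm_num)
    have h6 : 2 ^ 5 * (n + 1) ^ 3 ≤ (n + 1) ^ 8 := by
      rw [show (n + 1) ^ 8 = (n + 1) ^ 5 * (n + 1) ^ 3 by rw [← pow_add]]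
      exact Nat.mul_le_mul_right _ h4
    omega
  have : Nonempty (Fin n) := ⟨⟨0, hn⟩⟩
  obtain ⟨y₀, z₀, k₀, hy₀, hK₀⟩ := exists_good hG
  obtain ⟨t, ht, r, m, hs, y, z, k, hS, hm⟩ :=
    triple_search hW hn (A := adjEntry G) (fun i _ j _ => closedEntry_le (G := G) i j) (search 0) 0
      (init G).reg (init G).mem ⟨[], [], by simp, rfl⟩ ⟨fun x => rfl, fun i hi j hj => init_mem i j hi hj⟩
  change Saved n (closedEntry G) _ y z k at hS
  change ∀ v < n, m (n * n + v) = kap (closedEntry G) y z k v at hm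
  have hle : ∀ {y z k : ℕ}, y < n → z < n → k < 2 → ∀ v < n, kap (closedEntry G) y z k v ≤ 1 :=
    fun hy hz hk v hv => kap_le (fun i _ j _ => closedEntry_le i j) hy hz hk hv
  obtain ⟨k₁, hk₁, hk₁'⟩ : ∃ k₁ < 2, (k₁ = 1) = k₀ := by
    by_cases h : k₀
    · exact ⟨1, by norm_num, by simp [h]⟩
    · exact ⟨0, by norm_num, by simp [h]⟩
  have hcand : {v : Fin n | kap (closedEntry G) y₀ z₀ k₁ v = 1} = cand G y₀ z₀ k₀ := by
    ext v
    rw [← hk₁']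
    exact kap_eq_one y₀ z₀ v hk₁
  have h0 := hS.defect y₀ y₀.2 z₀ z₀.2 k₁ hk₁ trivial
    (defect_of_isSimplicialClique (hle y₀.2 z₀.2 hk₁) (by
      have : y₀ ∈ {v : Fin n | kap (closedEntry G) y₀ z₀ k₁ v = 1} := hcand ▸ hy₀
      exact this) (hcand ▸ hK₀))
  have hκ := hle hS.y_lt hS.z_lt hS.k_lt
  refine ⟨{v | kap (closedEntry G) y z k v = 1},
    isSimplicialClique_of_defect hκ (y := ⟨y, hS.y_lt⟩) h0, t, _, ht, hs, ?_, fun i => ?_⟩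
  · simp [Halted]
  · change m (n * n + i) = _
    rw [hm i i.2]
    by_cases h : kap (closedEntry G) y z k i = 1
    · simp [h]
    · simp [eq_zero_of_le_one (hκ i i.2) h]

end WordRAM

theorem mainTheorem4 :
    ∃ (P : WordRAM.Program) (c C : ℕ), 0 < c ∧
      ∀ (n : ℕ) (G : SimpleGraph (Fin n)), 0 < n → IsClean G →
        ∃ K : Set (Fin n), IsSimplicialClique G K ∧
          WordRAM.Computes (c * Nat.size n) P G (C * n ^ 5) K :=
  ⟨WordRAM.search 0, 8, 200, by norm_num, fun _ _ hn hG => WordRAM.computes_search hn hG⟩
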